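/- For $\theta\in[0,1]$ write $\mathbf A\sim\mathsf{BG}(s,s,\theta)$ if $\mathbf A\in\mathbb R^{s\times s}$ is the random matrix with entries $A_{ij}=B_{ij}\xi_{ij}$, where all $B_{ij}\sim\mathrm{Ber}(\theta)$ and $\xi_{ij}\sim\mathcal N(0,1)$ are mutually independent. For $\hat{\mathbf A},\mathbf A\in\mathbb R^{s\times s}$ put $$d(\hat{\mathbf A},\mathbf A)=\min_{\Pi,\Delta}|\hat{\mathbf A}\Pi\Delta-\mathbf A|_\infty,$$ where $|M|_\infty=\max_{i,j}|M_{ij}|$, $\Pi$ ranges over the $s\times s$ permutation matrices and $\Delta$ over the diagonal matrices with diagonal entries in $\{-1,1\}$. Let $\mathcal W(\boldsymbol\Sigma,n)$ be the law of $\frac1n\sum_{k=1}^nX_kX_k^\top$ with $X_1,\dots,X_n$ i.i.d. $\mathcal N(0,\boldsymbol\Sigma)$. An algorithm is a program for a random access machine with exact real arithmetic (operations $+,-,\times,/,\sqrt{\cdot}$ and comparison, rational constants) that halts on every $s\times s$ input matrix, for every $s$, and outputs an $s\times s$ matrix; the same program serves all $s$. Fix $\alpha$ with $\frac12<\alpha<1$.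 For each $s$ let $\mathbf A\sim\mathsf{BG}(s,s,\theta)$ with $\theta=s^{-\alpha}$, and let $\boldsymbol\Sigma=\mathbf A\mathbf A^\top$. Then there is an algorithm which takes $\boldsymbol\Sigma$ as input and outputs $\hat{\mathbf A}$ such that $d(\hat{\mathbf A},\mathbf A)\to0$ in probability over the randomness of $\mathbf A$ as $s\to\infty$. Moreover, for every $\beta>\max\{3-4\alpha,\,1-\alpha\}$ there is an algorithm which takes as input a sample covariance matrix $\overline{\boldsymbol\Sigma}$ that, given $\mathbf A$, has the distribution $\mathcal W(\boldsymbol\Sigma,n)$, where $n$ is $s^{2\beta}$ up to rounding to an integer (upwards or downwards), and outputs $\hat{\mathbf A}$ such that $d(\hat{\mathbf A},\mathbf A)\to0$ in probability over the randomness of $\mathbf A$ and $\overline{\boldsymbol\Sigma}$ as $s\to\infty$. -/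

import Mathlib

open MeasureTheory ProbabilityTheory Filter Topology

noncomputable section

namespace SparseICA

/-! ### Random matrices -/

/-- Matrices carry the product σ-algebra of their entries. -/
instance instMeasurableSpaceMatrix {m n : Type*} : MeasurableSpace (Matrix m n ℝ) :=
  inferInstanceAs (MeasurableSpace (m → n → ℝ))

/-- The Bernoulli-Gaussian ensemble `BG(r, s, θ)`: the law of the matrix with entries
`B i j * ξ i j`, where all the `B i j ∼ Ber(θ)` and `ξ i j ∼ N(0, 1)` are mutually independent.
A sample point `ω` lists the pairs `(B i j, ξ i j)`. -/
def bernoulliGaussian (r s : ℕ) (θ : unitInterval) : Measure (Matrix (Fin r) (Fin s) ℝ) :=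
  (Measure.pi fun _ : Fin r × Fin s =>
    (bernoulliMeasure (1 : ℝ) 0 θ).prod (gaussianReal 0 1)).map
    fun ω => Matrix.of fun i j => (ω (i, j)).1 * (ω (i, j)).2

/-- The (normalized) Wishart distribution `W(Σ, n)`: the law of the sample covariance matrix
`n⁻¹ ∑ₖ Xₖ Xₖᵀ` of i.i.d. vectors `X₁, …, Xₙ ∼ N(0, Σ)`. -/
def wishart {r : ℕ} (S : Matrix (Fin r) (Fin r) ℝ) (n : ℕ) : Measure (Matrix (Fin r) (Fin r) ℝ) :=
  (Measure.pi fun _ : Fin n => multivariateGaussian (0 : EuclideanSpace ℝ (Fin r)) S).map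
    fun X => Matrix.of fun i j => (n : ℝ)⁻¹ * ∑ k, X k i * X k j

/-! ### The recovery distance -/

/-- The entrywise supremum norm `|M|_∞` (`0` for a matrix without entries). -/
def entrySup {r s : ℕ} (M : Matrix (Fin r) (Fin s) ℝ) : ℝ :=
  ⨆ p : Fin r × Fin s, |M p.1 p.2|

/-- `d(Â, A) = min |Â Π Δ - A|_∞`, over the permutation matrices `Π` and the diagonal matrices
`Δ` with diagonal entries `±1`; the infimum is over a finite non-empty set. -/
def recoveryDist {r s : ℕ} (Ahat A : Matrix (Fin r) (Fin s) ℝ) : ℝ :=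
  ⨅ p : Equiv.Perm (Fin s) × (Fin s → ℤˣ),
    entrySup (Ahat * p.1.permMatrix ℝ * Matrix.diagonal (fun j => ((p.2 j : ℤ) : ℝ)) - A)

/-! ### Algorithms

Algorithms are programs for a random access machine with exact real arithmetic: finitely many
registers for natural numbers, and arrays of real numbers with two natural number addresses.
The operations on reals are the four arithmetic operations, square root, comparison, and
conversion of a natural number; the only real constants in a program are rational. -/

/-- Memory: `reg k` is the `k`-th register, `arr a i j` the cell `(i, j)` of the `a`-th array. -/
structure Mem where
  reg : ℕ → ℕ
  arr : ℕ → ℕ → ℕ → ℝ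

/-- Expressions for natural numbers (with truncated subtraction). -/
inductive NatExp where
  | const (n : ℕ)
  | reg (k : ℕ)
  | add (e f : NatExp)
  | sub (e f : NatExp)
  | mul (e f : NatExp)

def NatExp.eval (σ : Mem) : NatExp → ℕ
  | const n => n
  | reg k => σ.reg k
  | add e f => e.eval σ + f.eval σ
  | sub e f => e.eval σ - f.eval σ
  | mul e f => e.eval σ * f.eval σ

/-- Expressions for real numbers. Division by zero and the square root of a negative number
return `0`. -/
inductive RealExp where
  | const (q : ℚ)
  | ofNat (e : NatExp)
  | read (a : ℕ) (i j : NatExp)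
  | add (e f : RealExp)
  | sub (e f : RealExp)
  | mul (e f : RealExp)
  | div (e f : RealExp)
  | sqrt (e : RealExp)

def RealExp.eval (σ : Mem) : RealExp → ℝ
  | const q => (q : ℝ)
  | ofNat e => (e.eval σ : ℝ)
  | read a i j => σ.arr a (i.eval σ) (j.eval σ)
  | add e f => e.eval σ + f.eval σ
  | sub e f => e.eval σ - f.eval σ
  | mul e f => e.eval σ * f.eval σ
  | div e f => e.eval σ / f.eval σ
  | sqrt e => Real.sqrt (e.eval σ)

/-- Tests. -/
inductive Test where
  | natLt (e f : NatExp)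
  | realLt (e f : RealExp)
  | not (b : Test)
  | and (b c : Test)

def Test.holds (σ : Mem) : Test → Prop
  | natLt e f => e.eval σ < f.eval σ
  | realLt e f => e.eval σ < f.eval σ
  | not b => ¬ b.holds σ
  | and b c => b.holds σ ∧ c.holds σ

/-- Programs. -/
inductive Program where
  | skip
  | setReg (k : ℕ) (e : NatExp)
  | write (a : ℕ) (i j : NatExp) (e : RealExp)
  | seq (P Q : Program)
  | cond (b : Test) (P Q : Program)
  | loop (b : Test) (P : Program)

def Mem.setReg (σ : Mem) (k n : ℕ) : Mem :=
  { σ with reg := fun l => if l = k then n else σ.reg l }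

def Mem.write (σ : Mem) (a i j : ℕ) (x : ℝ) : Mem :=
  { σ with arr := fun b k l => if b = a ∧ k = i ∧ l = j then x else σ.arr b k l }

/-- `Runs P σ τ`: the program `P`, started with memory `σ`, halts after finitely many steps, with
memory `τ`. The program `loop b P` repeats `P` as long as `b` holds. -/
inductive Runs : Program → Mem → Mem → Prop where
  | skip (σ : Mem) : Runs .skip σ σ
  | setReg (k : ℕ) (e : NatExp) (σ : Mem) : Runs (.setReg k e) σ (σ.setReg k (e.eval σ))
  | write (a : ℕ) (i j : NatExp) (e : RealExp) (σ : Mem) :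
      Runs (.write a i j e) σ (σ.write a (i.eval σ) (j.eval σ) (e.eval σ))
  | seq {P Q : Program} {σ σ' τ : Mem} : Runs P σ σ' → Runs Q σ' τ → Runs (.seq P Q) σ τ
  | condTrue {b : Test} {P Q : Program} {σ τ : Mem} :
      b.holds σ → Runs P σ τ → Runs (.cond b P Q) σ τ
  | condFalse {b : Test} {P Q : Program} {σ τ : Mem} :
      ¬ b.holds σ → Runs Q σ τ → Runs (.cond b P Q) σ τ
  | loopTrue {b : Test} {P : Program} {σ σ' τ : Mem} :
      b.holds σ → Runs P σ σ' → Runs (.loop b P) σ' τ → Runs (.loop b P) σ τ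
  | loopFalse {b : Test} {P : Program} {σ : Mem} : ¬ b.holds σ → Runs (.loop b P) σ σ

/-- The initial memory for an `s × s` input matrix `M`: `s` is in register `0` and `M` is in
array `0`; every other register and cell is `0`. -/
def Mem.input (s : ℕ) (M : Matrix (Fin s) (Fin s) ℝ) : Mem where
  reg k := if k = 0 then s else 0
  arr a i j := if h : a = 0 ∧ i < s ∧ j < s then M ⟨i, h.2.1⟩ ⟨j, h.2.2⟩ else 0

/-- The `s × s` output matrix, read off from array `1`. -/
def Mem.output (s : ℕ) (τ : Mem) : Matrix (Fin s) (Fin s) ℝ :=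
  Matrix.of fun i j => τ.arr 1 i j

/-- `P` halts on every square input matrix `M`, of every size `s`, with output `alg s M`. -/
def Program.Computes (P : Program)
    (alg : (s : ℕ) → Matrix (Fin s) (Fin s) ℝ → Matrix (Fin s) (Fin s) ℝ) : Prop :=
  ∀ (s : ℕ) (M : Matrix (Fin s) (Fin s) ℝ),
    ∃ τ : Mem, Runs P (Mem.input s M) τ ∧ τ.output s = alg s M

end SparseICA

end

namespace SparseICA

/-! The model does not limit running time, so the algorithm is an exhaustive search over a grid of
matrices `V`. The content is that the Gram matrix, even perturbed by `x ^ (-11)` in each entry,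
determines a sparse `A` up to permutation and signs of columns. Here `x = s ^ (1 / 2 ^ b)` is a
small power of `s`, computable by `b` square roots; `c = 2 ^ b`, so that `x ^ c = s`; and `x ^ (κ +
10) ≤ s θ ≤ x ^ (κ + 11)`. The exponents α and β enter the program only through the integers `b` and
`κ`.

Say that two rows meet if they are both nonzero in some column. As α > 1/2, the mean overlap `s θ²`
of two rows is a negative power of `s`. Hence for fixed `i` and `l`, all but `x ^ κ` of the rows `j`
in the support of column `l` meet row `i` in no other column, and for these the Gram entry is just
`A i l * A j l`. So the rounding of `A` to the grid passes the test `Accepts`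
(`IsTypical.exists_accepts`).

Conversely, let `v` be a column of an accepted `V` and `J` the set of rows where `|v| ≥ 1`. For `i`
in `J` the Gram entries at most `j` in `J` are close to `v i * v j`, hence nonzero: most pairs of
rows in `J` meet. This forces a large part of `J` into one column `l` (`IsTypical.exists_column`).
Otherwise one could choose `2 c` rows in `J`, no three sharing a column; most rows of `J` meet all
of them, hence meet the union of their supports at least `c` times. But one such hit has probability
at most about `x ^ (-17)`, so `c` hits have probability about `s ^ (-17)`. Once `l` is found, `v i *
v j` is close to `A i l * A j l` for most `j` in a large set, and this determines `v` up to sign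
(`exists_sign_close`). Separation of the columns of `V` makes `v ↦ l` injective, hence a
permutation.

The properties in `IsTypical` fail with probability at most a power of `s` times `exp (-x / 2)`
(`IsRegime.prob_not_typical`). For a sample covariance matrix, `wishart_deviation_le` bounds the
entrywise error by `x ^ (-11)` once `n` exceeds the squared row norms of `A`, squared, by a suitable
power of `x`; these norms squared are at most `x ^ (κ + 14)`, so `n = s ^ (2 β)` with β > 1 - α is
enough for a large `b`. -/

/-! ### Search by a random access machine -/

/-- The `2 ^ b`-th root of `s`. -/
noncomputable def scale (b s : ℕ) : ℝ := Real.sqrt^[b] s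

/-- The matrices with entries `d / s - s`, for natural numbers `d ≤ 2 s²`. -/
def IsGrid {s : ℕ} (V : Matrix (Fin s) (Fin s) ℝ) : Prop :=
  ∀ i j, ∃ d : ℕ, d ≤ 2 * (s * s) ∧ V i j = (d : ℝ) / s - s

open Classical in
/-- The columns of `V` are well separated, and the matrix `v vᵀ` of each column `v` agrees with `M`
up to few exceptions in every row, when restricted to the large entries of `v`. -/
structure Accepts {s : ℕ} (x : ℝ) (κ : ℕ) (M V : Matrix (Fin s) (Fin s) ℝ) : Prop where
  large : ∀ k, x ^ (κ + 9) ≤ (Finset.univ.filter fun j => 1 ≤ |V j k|).card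
  agree : ∀ k i, ((Finset.univ.filter fun j =>
    1 ≤ |V j k| ∧ 1 < x ^ 10 * |M i j - V i k * V j k|).card : ℝ) ≤ x ^ (κ + 1)
  separated : ∀ k k', k ≠ k' → ∃ j, 1 ≤ |V j k| ∧ |V j k'| < 1 / 2

theorem card_filter_fin_eq_count (s : ℕ) (p : ℕ → Prop) [DecidablePred p]
    [DecidablePred fun j : Fin s => p j] : (Finset.univ.filter fun j : Fin s => p j).card = Nat.count p s := by
  rw [Nat.count_eq_card_filter_range, Finset.card_filter, Finset.card_filter,
    ← Fin.sum_univ_eq_sum_range (fun j => if p j then 1 else 0)]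
  exact Finset.sum_congr rfl fun j _ => by congr

/-! ### Derived expressions, counted loops and counters. -/

/-- The absolute value of a real expression. -/
def RealExp.abs (e : RealExp) : RealExp := .sqrt (.mul e e)

@[simp] theorem RealExp.eval_abs (σ : Mem) (e : RealExp) : e.abs.eval σ = |e.eval σ| := by
  simp [RealExp.abs, RealExp.eval, Real.sqrt_mul_self_eq_abs]

/-- The powers of a real expression. -/
def RealExp.pow (e : RealExp) : ℕ → RealExp
  | 0 => .const 1
  | n + 1 => .mul (RealExp.pow e n) e

@[simp] theorem RealExp.eval_pow (σ : Mem) (e : RealExp) (n : ℕ) :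
    (e.pow n).eval σ = e.eval σ ^ n := by
  induction n with
  | zero => simp [RealExp.pow, RealExp.eval]
  | succ n ih => simp [RealExp.pow, RealExp.eval, ih, pow_succ]

/-- Iterated square roots of the content of register `0`. -/
def RealExp.root : ℕ → RealExp
  | 0 => .ofNat (.reg 0)
  | n + 1 => .sqrt (RealExp.root n)

@[simp] theorem RealExp.eval_root (σ : Mem) (b : ℕ) :
    (RealExp.root b).eval σ = scale b (σ.reg 0) := by
  induction b with
  | zero => simp [RealExp.root, RealExp.eval, scale, NatExp.eval]
  | succ n ih =>
    simp only [scale] at ih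
    simp [RealExp.root, RealExp.eval, ih, scale, Function.iterate_succ_apply']

/-- Run `P` for the values `0, 1, …` of register `k` below the content of register `r`. -/
def Program.forLoop (k r : ℕ) (P : Program) : Program :=
  .seq (.setReg k (.const 0))
    (.loop (.natLt (.reg k) (.reg r)) (.seq P (.setReg k (.add (.reg k) (.const 1)))))

/-- The invariant rule for counted loops. The invariant is evaluated after the counter has been
updated, and the body must restore both the counter and the bound. -/
theorem Program.runs_forLoop {k r : ℕ} {P : Program} (I : ℕ → Mem → Prop) {σ : Mem} (hkr : k ≠ r)
    (h0 : I 0 (σ.setReg k 0))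
    (hP : ∀ i < σ.reg r, ∀ τ : Mem, τ.reg k = i → τ.reg r = σ.reg r → I i τ →
      ∃ τ', Runs P τ τ' ∧ τ'.reg k = i ∧ τ'.reg r = σ.reg r ∧ I (i + 1) (τ'.setReg k (i + 1))) :
    ∃ τ, Runs (Program.forLoop k r P) σ τ ∧ I (σ.reg r) τ := by
  -- Induction on the number `m` of rounds that remain.
  have key : ∀ m i : ℕ, i + m = σ.reg r → ∀ τ : Mem, τ.reg k = i → τ.reg r = σ.reg r → I i τ →
      ∃ τ', Runs (.loop (.natLt (.reg k) (.reg r))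
        (.seq P (.setReg k (.add (.reg k) (.const 1))))) τ τ' ∧ I (σ.reg r) τ' := by
    intro m
    induction m with
    | zero =>
      intro i hi τ hk hr hI
      refine ⟨τ, Runs.loopFalse ?_, by simpa [← hi] using hI⟩
      simp only [Test.holds, NatExp.eval]; omega
    | succ m ih =>
      intro i hi τ hk hr hI
      obtain ⟨τ', h1, h2, h3, h4⟩ := hP i (by omega) τ hk hr hI
      obtain ⟨τ'', h5, h6⟩ := ih (i + 1) (by omega) (τ'.setReg k (i + 1)) (by simp [Mem.setReg])
        (by simp [Mem.setReg, h3, hkr.symm]) h4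
      refine ⟨τ'', Runs.loopTrue ?_ (Runs.seq h1 ?_) h5, h6⟩
      · simp only [Test.holds, NatExp.eval]; omega
      · have := Runs.setReg k (.add (.reg k) (.const 1)) τ'
        simpa [NatExp.eval, h2] using this
  obtain ⟨τ, h1, h2⟩ := key (σ.reg r) 0 (by simp) (σ.setReg k 0) (by simp [Mem.setReg])
    (by simp [Mem.setReg, hkr.symm]) h0
  exact ⟨τ, Runs.seq (Runs.setReg k (.const 0) σ) h1, h2⟩

/-- The registers below `k`, except the violation counter `5`, and all arrays are the same. -/
structure Agree (k : ℕ) (σ τ : Mem) : Prop where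
  reg : ∀ l < k, l ≠ 5 → τ.reg l = σ.reg l
  arr : τ.arr = σ.arr

theorem Agree.refl (k : ℕ) (σ : Mem) : Agree k σ σ := ⟨fun _ _ _ => rfl, rfl⟩

theorem Agree.trans {k : ℕ} {σ τ υ : Mem} (h : Agree k σ τ) (h' : Agree k τ υ) : Agree k σ υ :=
  ⟨fun l hl h5 => (h'.reg l hl h5).trans (h.reg l hl h5), h'.arr.trans h.arr⟩

theorem Agree.mono {k m : ℕ} {σ τ : Mem} (h : Agree k σ τ) (hm : m ≤ k) : Agree m σ τ :=
  ⟨fun l hl h5 => h.reg l (by omega) h5, h.arr⟩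

theorem Agree.setReg {k m n : ℕ} {σ τ : Mem} (h : Agree k σ τ) (hm : k ≤ m) :
    Agree k σ (τ.setReg m n) :=
  ⟨fun l hl h5 => by simpa [Mem.setReg, show l ≠ m by omega] using h.reg l hl h5, h.arr⟩

theorem Agree.setReg_five {k n : ℕ} {σ τ : Mem} (h : Agree k σ τ) : Agree k σ (τ.setReg 5 n) :=
  ⟨fun l hl h5 => by simpa [Mem.setReg, h5] using h.reg l hl h5, h.arr⟩

/-- Count into register `9` the values of register `8` below `s` for which `t` holds. -/
def countLoop (t : Test) : Program :=
  .seq (.setReg 9 (.const 0))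
    (.forLoop 8 0 (.cond t (.setReg 9 (.add (.reg 9) (.const 1))) .skip))

theorem runs_countLoop (t : Test) (σ : Mem) (p : ℕ → Prop) [DecidablePred p]
    (hp : ∀ τ, Agree 8 σ τ → (t.holds τ ↔ p (τ.reg 8))) :
    ∃ τ, Runs (countLoop t) σ τ ∧ Agree 8 σ τ ∧ τ.reg 5 = σ.reg 5 ∧
      τ.reg 9 = Nat.count p (σ.reg 0) := by
  obtain ⟨τ, h1, h2⟩ := Program.runs_forLoop (k := 8) (r := 0)
    (P := .cond t (.setReg 9 (.add (.reg 9) (.const 1))) .skip)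
    (fun i τ => Agree 8 σ τ ∧ τ.reg 5 = σ.reg 5 ∧ τ.reg 9 = Nat.count p i)
    (σ := σ.setReg 9 0) (by norm_num)
    ⟨((Agree.refl 8 σ).setReg (by norm_num)).setReg (by norm_num), by simp [Mem.setReg],
      by simp [Mem.setReg]⟩ (by
      rintro i hi τ h8 h0 ⟨hA, h5, h9⟩
      by_cases ht : t.holds τ
      · refine ⟨_, Runs.condTrue ht (Runs.setReg _ _ _), by simpa [Mem.setReg] using h8,
          by simpa [Mem.setReg] using h0, (hA.setReg (by norm_num)).setReg (by norm_num),
          by simpa [Mem.setReg] using h5, ?_⟩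
        have := (hp τ hA).1 ht
        rw [h8] at this
        simp [Mem.setReg, NatExp.eval, h9, Nat.count_succ, this]
      · refine ⟨_, Runs.condFalse ht (Runs.skip _), h8, h0, hA.setReg (by norm_num),
          by simpa [Mem.setReg] using h5, ?_⟩
        have := mt (hp τ hA).2 ht
        rw [h8] at this
        simp [Mem.setReg, h9, Nat.count_succ, this])
  exact ⟨τ, Runs.seq (Runs.setReg 9 (.const 0) σ) h1, by simpa [Mem.setReg] using h2⟩

/-- Increase the violation counter unless `t` holds. -/
def require (t : Test) : Program := .cond t .skip (.setReg 5 (.add (.reg 5) (.const 1)))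

/-- Register `5` remains `0` exactly as long as every requirement holds, so successive requirements
form a conjunction. -/
theorem runs_require (t : Test) (σ : Mem) (φ : Prop) (hφ : t.holds σ ↔ φ) (k : ℕ) :
    ∃ τ, Runs (require t) σ τ ∧ Agree k σ τ ∧ (τ.reg 5 = 0 ↔ σ.reg 5 = 0 ∧ φ) := by
  by_cases ht : t.holds σ
  · exact ⟨σ, Runs.condTrue ht (Runs.skip _), Agree.refl _ _, by simp [← hφ, ht]⟩
  · exact ⟨_, Runs.condFalse ht (Runs.setReg _ _ _), (Agree.refl _ _).setReg_five,
      by simp [Mem.setReg, NatExp.eval, ← hφ, ht]⟩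

/-- Count the values for which `t` holds, and check the result with `u`. -/
theorem runs_countLoop_require (t u : Test) (σ : Mem) (p : ℕ → Prop) [DecidablePred p]
    (φ : Prop)
    (hp : ∀ τ, Agree 8 σ τ → (t.holds τ ↔ p (τ.reg 8)))
    (hu : ∀ τ, Agree 8 σ τ → τ.reg 9 = Nat.count p (σ.reg 0) →
      (u.holds τ ↔ φ)) :
    ∃ τ, Runs (.seq (countLoop t) (require u)) σ τ ∧ Agree 8 σ τ ∧
      (τ.reg 5 = 0 ↔ σ.reg 5 = 0 ∧ φ) := by
  obtain ⟨τ, h1, h2, h3, h4⟩ := runs_countLoop t σ p hp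
  obtain ⟨τ', h5, h6, h7⟩ := runs_require u τ φ (hu τ h2 h4) 8
  exact ⟨τ', Runs.seq h1 h5, h2.trans h6, by rw [h7, h3]⟩

/-- A loop of requirements is a bounded universal quantifier. Nested quantifiers use increasing loop
registers, so an inner loop preserves the registers of the outer ones. -/
theorem runs_forLoop_all {k : ℕ} (hk : 5 < k) {P : Program} (σ : Mem) (φ : ℕ → Prop)
    (hP : ∀ i < σ.reg 0, ∀ τ, Agree k σ τ → τ.reg k = i →
      ∃ τ', Runs P τ τ' ∧ Agree (k + 1) τ τ' ∧ (τ'.reg 5 = 0 ↔ τ.reg 5 = 0 ∧ φ i)) :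
    ∃ τ, Runs (.forLoop k 0 P) σ τ ∧ Agree k σ τ ∧
      (τ.reg 5 = 0 ↔ σ.reg 5 = 0 ∧ ∀ i < σ.reg 0, φ i) := by
  obtain ⟨τ, h1, h2⟩ := Program.runs_forLoop (k := k) (r := 0) (P := P)
    (fun i τ => Agree k σ τ ∧ (τ.reg 5 = 0 ↔ σ.reg 5 = 0 ∧ ∀ j < i, φ j))
    (σ := σ) (by omega) ⟨(Agree.refl _ _).setReg le_rfl, by simp [Mem.setReg, hk.ne]⟩ (by
      rintro i hi τ hτk h0 ⟨hA, h5⟩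
      obtain ⟨τ', h6, h7, h8⟩ := hP i hi τ hA hτk
      refine ⟨τ', h6, by rw [h7.reg k (by omega) (by omega), hτk],
        by rw [h7.reg 0 (by omega) (by omega), h0],
        (hA.trans (h7.mono (by omega))).setReg le_rfl, ?_⟩
      simp only [Mem.setReg, hk.ne, if_false, h8, h5, Nat.lt_succ_iff_lt_or_eq]
      grind)
  exact ⟨τ, h1, h2⟩

/-! ### Testing one candidate. -/

/-- The entry of the candidate matrix, which is stored by rows in array `2`. -/
def candidate (i j : ℕ) : RealExp :=
  .read 2 (.add (.mul (.reg i) (.reg 0)) (.reg j)) (.const 0)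

def testLarge : Test := .not (.realLt (candidate 8 6).abs (.const 1))

def testDisagree (b : ℕ) : Test :=
  .realLt (.const 1) (.mul ((RealExp.root b).pow 10)
    (RealExp.sub (.read 0 (.reg 7) (.reg 8)) (.mul (candidate 7 6) (candidate 8 6))).abs)

/-- Set register `5` to `0` if and only if the candidate is accepted. -/
def checkProgram (b κ : ℕ) : Program :=
  .seq (.setReg 5 (.const 0)) <| .forLoop 6 0 <|
    .seq (.seq (countLoop testLarge)
      (require (.not (.realLt (.ofNat (.reg 9)) ((RealExp.root b).pow (κ + 9)))))) <|
    .seq (.forLoop 7 0 (.seq (countLoop (.and testLarge (testDisagree b)))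
      (require (.not (.realLt ((RealExp.root b).pow (κ + 1)) (.ofNat (.reg 9))))))) <|
    .forLoop 7 0 (.seq (countLoop (.and testLarge (.realLt (candidate 8 7).abs (.const (1 / 2)))))
      (require (.not (.and
        (.not (.and (.not (.natLt (.reg 6) (.reg 7))) (.not (.natLt (.reg 7) (.reg 6)))))
        (.natLt (.reg 9) (.const 1))))))

/-- The leading block of an array. -/
def block (s : ℕ) (f : ℕ → ℕ → ℝ) : Matrix (Fin s) (Fin s) ℝ := Matrix.of fun i j => f i j

/-- The matrix stored by rows in array `2`. -/
def unroll (s : ℕ) (w : ℕ → ℝ) : Matrix (Fin s) (Fin s) ℝ := block s fun i j => w (i * s + j)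

/-- Every memory reached during the check satisfies `Agree 6 σ`, so all tests read the original
input, candidate and size; only the loop registers need tracking. -/
theorem runs_checkProgram (b κ : ℕ) (σ : Mem) :
    ∃ τ, Runs (checkProgram b κ) σ τ ∧ Agree 6 σ τ ∧
      (τ.reg 5 = 0 ↔ Accepts (scale b (σ.reg 0)) κ (block (σ.reg 0) (σ.arr 0))
        (unroll (σ.reg 0) fun p => σ.arr 2 p 0)) := by
  classical
  set s := σ.reg 0 with hs
  set x := scale b s with hx
  set V : ℕ → ℕ → ℝ := fun i j => σ.arr 2 (i * s + j) 0 with hV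
  have hlarge : ∀ τ, Agree 6 σ τ → (testLarge.holds τ ↔ 1 ≤ |V (τ.reg 8) (τ.reg 6)|) := by
    intro τ hτ
    simp [testLarge, Test.holds, candidate, RealExp.eval, NatExp.eval, hτ.arr, V,
      hτ.reg 0 (by norm_num) (by norm_num), ← hs]
  have hdis : ∀ τ, Agree 6 σ τ → ((testDisagree b).holds τ ↔
      1 < x ^ 10 * |σ.arr 0 (τ.reg 7) (τ.reg 8) -
        V (τ.reg 7) (τ.reg 6) * V (τ.reg 8) (τ.reg 6)|) := by
    intro τ hτ
    simp [testDisagree, Test.holds, candidate, RealExp.eval, NatExp.eval, hτ.arr, V,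
      hτ.reg 0 (by norm_num) (by norm_num), ← hs, ← hx]
  obtain ⟨τ, h1, h2, h3⟩ := runs_forLoop_all (k := 6) (by norm_num) (P :=
      .seq (.seq (countLoop testLarge)
      (require (.not (.realLt (.ofNat (.reg 9)) ((RealExp.root b).pow (κ + 9)))))) <|
    .seq (.forLoop 7 0 (.seq (countLoop (.and testLarge (testDisagree b)))
      (require (.not (.realLt ((RealExp.root b).pow (κ + 1)) (.ofNat (.reg 9))))))) <|
    .forLoop 7 0 (.seq (countLoop (.and testLarge (.realLt (candidate 8 7).abs (.const (1 / 2)))))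
      (require (.not (.and
        (.not (.and (.not (.natLt (.reg 6) (.reg 7))) (.not (.natLt (.reg 7) (.reg 6)))))
        (.natLt (.reg 9) (.const 1)))))))
    (σ.setReg 5 0)
    (fun k => (x ^ (κ + 9) ≤ Nat.count (fun j => 1 ≤ |V j k|) s ∧
      (∀ i < s, (Nat.count (fun j => 1 ≤ |V j k| ∧ 1 < x ^ 10 * |σ.arr 0 i j - V i k * V j k|) s : ℝ)
        ≤ x ^ (κ + 1))) ∧
      ∀ k' < s, k ≠ k' → Nat.count (fun j => 1 ≤ |V j k| ∧ |V j k'| < 1 / 2) s ≠ 0) (by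
      intro k hk τ hτ hτk
      have hστ : Agree 6 σ τ := (Agree.refl _ _).setReg_five.trans hτ
      have hs0 : ∀ υ, Agree 6 σ υ → υ.reg 0 = s := fun υ hυ => hυ.reg 0 (by norm_num) (by norm_num)
      obtain ⟨τ₁, r1, a1, f1⟩ := runs_countLoop_require testLarge
        (.not (.realLt (.ofNat (.reg 9)) ((RealExp.root b).pow (κ + 9)))) τ
        (fun j => 1 ≤ |V j k|) (x ^ (κ + 9) ≤ Nat.count (fun j => 1 ≤ |V j k|) s)
        (fun υ hυ => by
          rw [hlarge υ (hστ.trans (hυ.mono (by norm_num))), hυ.reg 6 (by norm_num) (by norm_num), hτk])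
        (fun υ hυ h9 => by
          have h9' : υ.reg 9 = _ := h9
          rw [hs0 τ hστ] at h9'
          simp [Test.holds, RealExp.eval, NatExp.eval, h9', ← hx,
            hs0 υ (hστ.trans (hυ.mono (by norm_num)))])
      have hστ₁ : Agree 6 σ τ₁ := hστ.trans (a1.mono (by norm_num))
      have hτ₁k : τ₁.reg 6 = k := by rw [a1.reg 6 (by norm_num) (by norm_num), hτk]
      obtain ⟨τ₂, r2, a2, f2⟩ := runs_forLoop_all (k := 7) (by norm_num)
        (P := .seq (countLoop (.and testLarge (testDisagree b)))
          (require (.not (.realLt ((RealExp.root b).pow (κ + 1)) (.ofNat (.reg 9)))))) τ₁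
        (fun i => (Nat.count (fun j => 1 ≤ |V j k| ∧
          1 < x ^ 10 * |σ.arr 0 i j - V i k * V j k|) s : ℝ) ≤ x ^ (κ + 1))
        (fun i _ ρ hρ hρi => by
          have hσρ : Agree 6 σ ρ := hστ₁.trans (hρ.mono (by norm_num))
          have hρk : ρ.reg 6 = k := by rw [hρ.reg 6 (by norm_num) (by norm_num), hτ₁k]
          refine runs_countLoop_require _ _ ρ
            (fun j => 1 ≤ |V j k| ∧ 1 < x ^ 10 * |σ.arr 0 i j - V i k * V j k|) _
            (fun υ hυ => ?_) (fun υ hυ h9 => ?_)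
          · have hσυ := hσρ.trans (hυ.mono (show 6 ≤ 8 by norm_num))
            rw [Test.holds, hlarge υ hσυ, hdis υ hσυ, hυ.reg 6 (by norm_num) (by norm_num), hρk,
              hυ.reg 7 (by norm_num) (by norm_num), hρi]
          · have h9' : υ.reg 9 = _ := h9
            rw [hs0 ρ hσρ] at h9'
            simp [Test.holds, RealExp.eval, NatExp.eval, h9', ← hx,
              hs0 υ (hσρ.trans (hυ.mono (by norm_num)))])
      have hστ₂ : Agree 6 σ τ₂ := hστ₁.trans (a2.mono (by norm_num))
      have hτ₂k : τ₂.reg 6 = k := by rw [a2.reg 6 (by norm_num) (by norm_num), hτ₁k]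
      obtain ⟨τ₃, r3, a3, f3⟩ := runs_forLoop_all (k := 7) (by norm_num)
        (P := .seq (countLoop (.and testLarge (.realLt (candidate 8 7).abs (.const (1 / 2)))))
        (require (.not (.and
          (.not (.and (.not (.natLt (.reg 6) (.reg 7))) (.not (.natLt (.reg 7) (.reg 6)))))
          (.natLt (.reg 9) (.const 1)))))) τ₂
        (fun k' => k ≠ k' → Nat.count (fun j => 1 ≤ |V j k| ∧ |V j k'| < 1 / 2) s ≠ 0)
        (fun k' _ ρ hρ hρi => by
          have hσρ : Agree 6 σ ρ := hστ₂.trans (hρ.mono (by norm_num))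
          have hρk : ρ.reg 6 = k := by rw [hρ.reg 6 (by norm_num) (by norm_num), hτ₂k]
          refine runs_countLoop_require _ _ ρ
            (fun j => 1 ≤ |V j k| ∧ |V j k'| < 1 / 2) _
            (fun υ hυ => ?_) (fun υ hυ h9 => ?_)
          · have hσυ := hσρ.trans (hυ.mono (show 6 ≤ 8 by norm_num))
            rw [Test.holds, hlarge υ hσυ, hυ.reg 6 (by norm_num) (by norm_num), hρk]
            simp [Test.holds, candidate, RealExp.eval, NatExp.eval, hσυ.arr, V, hs0 υ hσυ,
              hυ.reg 7 (by norm_num) (by norm_num), hρi]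
          · have h9' : υ.reg 9 = _ := h9
            rw [hs0 ρ hσρ] at h9'
            simp only [Test.holds, NatExp.eval, h9', hυ.reg 7 (by norm_num) (by norm_num), hρi,
              hυ.reg 6 (by norm_num) (by norm_num), hρk]
            constructor
            · intro h hne h0
              exact h ⟨by omega, by omega⟩
            · rintro h ⟨hn, h'⟩
              exact h (fun e => hn ⟨by omega, by omega⟩) (by omega))
      refine ⟨τ₃, Runs.seq r1 (Runs.seq r2 r3), (a1.mono (by norm_num)).trans (a2.trans a3), ?_⟩
      rw [f3, f2, f1, hs0 τ₁ hστ₁, hs0 τ₂ hστ₂]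
      tauto)
  refine ⟨τ, Runs.seq (Runs.setReg 5 (.const 0) σ) h1, (Agree.refl _ _).setReg_five.trans h2, ?_⟩
  rw [h3]
  have e0 : (σ.setReg 5 0).reg 0 = s := by simp [Mem.setReg, hs]
  have e5 : (σ.setReg 5 0).reg 5 = 0 := by simp [Mem.setReg]
  rw [e0]
  simp only [e5, true_and]
  constructor
  · intro h
    refine ⟨fun k => ?_, fun k i => ?_, fun k k' hkk' => ?_⟩
    · have := (h k k.2).1.1
      rw [← card_filter_fin_eq_count] at this
      exact this
    · have := (h k k.2).1.2 i i.2
      rw [← card_filter_fin_eq_count] at this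
      exact this
    · have := (h k k.2).2 k' k'.2 (by simpa [Fin.ext_iff] using hkk')
      rw [← card_filter_fin_eq_count, Finset.card_ne_zero] at this
      obtain ⟨j, hj⟩ := this
      exact ⟨j, (Finset.mem_filter.1 hj).2⟩
  · intro h k hk
    refine ⟨⟨?_, fun i hi => ?_⟩, fun k' hk' hkk' => ?_⟩
    · rw [← card_filter_fin_eq_count]
      exact h.large ⟨k, hk⟩
    · rw [← card_filter_fin_eq_count]
      exact h.agree ⟨k, hk⟩ ⟨i, hi⟩
    · rw [← card_filter_fin_eq_count, Finset.card_ne_zero]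
      obtain ⟨j, hj⟩ := h.separated ⟨k, hk⟩ ⟨k', hk'⟩ (by simpa [Fin.ext_iff] using hkk')
      exact ⟨j, Finset.mem_filter.2 ⟨Finset.mem_univ _, hj⟩⟩

/-! ### Enumerating the grid. -/

/-- Quotient by register `1` of register `7`, into register `9`. -/
def divProgram : Program :=
  .seq (.setReg 9 (.const 0)) <| .forLoop 8 7 <|
    .cond (.natLt (.reg 7) (.mul (.add (.reg 8) (.const 1)) (.reg 1))) .skip
      (.setReg 9 (.add (.reg 8) (.const 1)))

/-- The quotient is at most the dividend, so a loop up to the dividend reaches it: after `i` rounds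
register `9` holds the minimum of `i` and the quotient. -/
theorem runs_divProgram (σ : Mem) (hB : 0 < σ.reg 1) :
    ∃ τ, Runs divProgram σ τ ∧ (∀ l < 8, τ.reg l = σ.reg l) ∧ τ.arr = σ.arr ∧
      τ.reg 9 = σ.reg 7 / σ.reg 1 := by
  obtain ⟨τ, h1, h2, h3, h4⟩ := Program.runs_forLoop (k := 8) (r := 7)
    (P := .cond (.natLt (.reg 7) (.mul (.add (.reg 8) (.const 1)) (.reg 1))) .skip
      (.setReg 9 (.add (.reg 8) (.const 1))))
    (fun i τ => (∀ l < 8, τ.reg l = σ.reg l) ∧ τ.arr = σ.arr ∧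
      τ.reg 9 = min i (σ.reg 7 / σ.reg 1)) (σ := σ.setReg 9 0) (by norm_num)
    ⟨fun l hl => by simp [Mem.setReg, show l ≠ 8 by omega, show l ≠ 9 by omega], rfl,
      by simp [Mem.setReg]⟩ (by
      rintro i hi τ h8 h7 ⟨hA, harr, h9⟩
      have e1 := hA 1 (by norm_num)
      have e7 := hA 7 (by norm_num)
      by_cases ht : (Test.natLt (.reg 7) (.mul (.add (.reg 8) (.const 1)) (.reg 1))).holds τ
      · refine ⟨_, Runs.condTrue ht (Runs.skip _), h8, h7, fun l hl => ?_, harr, ?_⟩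
        · simpa [Mem.setReg, show l ≠ 8 by omega] using hA l hl
        · simp only [Test.holds, NatExp.eval, h8, e1, e7] at ht
          have : σ.reg 7 / σ.reg 1 < i + 1 := (Nat.div_lt_iff_lt_mul hB).2 ht
          simp only [Mem.setReg, h9]
          norm_num
          omega
      · refine ⟨_, Runs.condFalse ht (Runs.setReg _ _ _), by simpa [Mem.setReg] using h8,
          by simpa [Mem.setReg] using h7, fun l hl => ?_, harr, ?_⟩
        · simpa [Mem.setReg, show l ≠ 8 by omega, show l ≠ 9 by omega] using hA l hl
        · simp only [Test.holds, NatExp.eval, h8, e1, e7, not_lt] at ht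
          have : i + 1 ≤ σ.reg 7 / σ.reg 1 := (Nat.le_div_iff_mul_le hB).2 ht
          simp only [Mem.setReg, NatExp.eval, h8]
          norm_num
          omega)
  refine ⟨τ, Runs.seq (Runs.setReg 9 (.const 0) σ) h1, h2, h3, ?_⟩
  rw [h4]
  simp only [Mem.setReg]
  norm_num
  exact Nat.div_le_self _ _

/-- The matrix entry that the digit at place `p` of `N` in base `B` stands for. -/
noncomputable def gridEntry (s B N p : ℕ) : ℝ := ((N / B ^ p % B : ℕ) : ℝ) / s - s

/-- Write the digits of register `4` into array `2`. -/
def decodeProgram : Program :=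
  .seq (.setReg 7 (.reg 4)) <| .forLoop 6 3 <| .seq divProgram <|
    .seq (.write 2 (.reg 6) (.const 0) (.sub
      (.div (.ofNat (.sub (.reg 7) (.mul (.reg 9) (.reg 1)))) (.ofNat (.reg 0)))
      (.ofNat (.reg 0)))) (.setReg 7 (.reg 9))

/-- Digits are split off by repeated division: after `i` of them, register `7` holds the number
divided by the `i`-th power of the base. -/
theorem runs_decodeProgram (σ : Mem) (hB : 0 < σ.reg 1) :
    ∃ τ, Runs decodeProgram σ τ ∧ (∀ l < 6, τ.reg l = σ.reg l) ∧
      (∀ a ≠ 2, τ.arr a = σ.arr a) ∧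
      ∀ p < σ.reg 3, τ.arr 2 p 0 = gridEntry (σ.reg 0) (σ.reg 1) (σ.reg 4) p := by
  obtain ⟨τ, h1, h2, h3, h4⟩ := Program.runs_forLoop (k := 6) (r := 3)
    (P := .seq divProgram <|
    .seq (.write 2 (.reg 6) (.const 0) (.sub
      (.div (.ofNat (.sub (.reg 7) (.mul (.reg 9) (.reg 1)))) (.ofNat (.reg 0)))
      (.ofNat (.reg 0)))) (.setReg 7 (.reg 9)))
    (fun i τ => (∀ l < 6, τ.reg l = σ.reg l) ∧ (∀ a ≠ 2, τ.arr a = σ.arr a) ∧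
      (∀ p < i, τ.arr 2 p 0 = gridEntry (σ.reg 0) (σ.reg 1) (σ.reg 4) p) ∧
      τ.reg 7 = σ.reg 4 / σ.reg 1 ^ i) (σ := σ.setReg 7 (σ.reg 4)) (by norm_num)
    ⟨fun l hl => by simp [Mem.setReg, show l ≠ 6 by omega, show l ≠ 7 by omega],
      fun a _ => rfl, by simp, by simp [Mem.setReg]⟩ (by
      rintro i hi τ h6 h3 ⟨hA, harr, hd, h7⟩
      obtain ⟨υ, r1, f1, f2, f3⟩ := runs_divProgram τ (by rw [hA 1 (by norm_num)]; exact hB)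
      refine ⟨_, Runs.seq r1 (Runs.seq (Runs.write _ _ _ _ _) (Runs.setReg _ _ _)),
        ?_, ?_, fun l hl => ?_, fun a ha => ?_, fun p hp => ?_, ?_⟩
      · simp [Mem.setReg, Mem.write, f1 6 (by norm_num), h6]
      · simpa [Mem.setReg, Mem.write, f1 3 (by norm_num)] using h3
      · simp [Mem.setReg, Mem.write, show l ≠ 6 by omega, show l ≠ 7 by omega, f1 l (by omega),
          hA l hl]
      · rw [← harr a ha, ← f2]
        funext j k
        simp [Mem.setReg, Mem.write, ha]
      · by_cases hpi : p = i
        · subst hpi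
          simp only [Mem.setReg, Mem.write, NatExp.eval, RealExp.eval, f1 6 (by norm_num), h6, f3,
            f1 7 (by norm_num), f1 0 (by norm_num), f1 1 (by norm_num), hA 0 (by norm_num),
            hA 1 (by norm_num), h7]
          have : ∀ a b : ℕ, a - a / b * b = a % b := fun a b => by
            have := Nat.div_add_mod a b
            rw [mul_comm] at this
            omega
          simp [this, gridEntry]
        · simp [Mem.setReg, Mem.write, NatExp.eval, f1 6 (by norm_num), h6, hpi, f2,
            hd p (by omega)]
      · simp [Mem.setReg, Mem.write, NatExp.eval, f3, h7, hA 1 (by norm_num), pow_succ,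
          Nat.div_div_eq_div_mul])
  refine ⟨τ, Runs.seq (Runs.setReg 7 (.reg 4) σ) h1, h2, h3, ?_⟩
  simpa [Mem.setReg] using h4.1

/-- Copy the candidate to the output. -/
def copyProgram : Program := .forLoop 6 0 (.forLoop 7 0 (.write 1 (.reg 6) (.reg 7) (candidate 6 7)))

theorem runs_copyProgram (σ : Mem) :
    ∃ τ, Runs copyProgram σ τ ∧ (∀ l < 6, τ.reg l = σ.reg l) ∧ (∀ a ≠ 1, τ.arr a = σ.arr a) ∧
      ∀ i < σ.reg 0, ∀ j < σ.reg 0, τ.arr 1 i j = σ.arr 2 (i * σ.reg 0 + j) 0 := by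
  obtain ⟨τ, h1, h2⟩ := Program.runs_forLoop (k := 6) (r := 0)
    (P := .forLoop 7 0 (.write 1 (.reg 6) (.reg 7) (candidate 6 7)))
    (fun n τ => (∀ l < 6, τ.reg l = σ.reg l) ∧ (∀ a ≠ 1, τ.arr a = σ.arr a) ∧
      ∀ i < n, ∀ j < σ.reg 0, τ.arr 1 i j = σ.arr 2 (i * σ.reg 0 + j) 0) (σ := σ) (by norm_num)
    ⟨fun l hl => by simp [Mem.setReg, show l ≠ 6 by omega], fun a _ => rfl, by simp⟩ (by
      rintro n hn τ h6 h0 ⟨hA, harr, hd⟩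
      obtain ⟨υ, r, h7, f1, f2, f3⟩ := Program.runs_forLoop (k := 7) (r := 0)
        (P := .write 1 (.reg 6) (.reg 7) (candidate 6 7))
        (fun m υ => (∀ l < 7, υ.reg l = τ.reg l) ∧ (∀ a ≠ 1, υ.arr a = σ.arr a) ∧
          (∀ i < n, ∀ j < σ.reg 0, υ.arr 1 i j = σ.arr 2 (i * σ.reg 0 + j) 0) ∧
          ∀ j < m, υ.arr 1 n j = σ.arr 2 (n * σ.reg 0 + j) 0) (σ := τ) (by norm_num)
        ⟨fun l hl => by simp [Mem.setReg, show l ≠ 7 by omega], harr, hd, by simp⟩ (by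
          rintro m hm υ h7 g0 ⟨gA, garr, gd, ge⟩
          have g6 : υ.reg 6 = n := (gA 6 (by norm_num)).trans h6
          refine ⟨_, Runs.write _ _ _ _ _, h7, g0, fun l hl => ?_, fun a ha => ?_,
            fun i hi j hj => ?_, fun j hj => ?_⟩
          · simpa [Mem.setReg, Mem.write, show l ≠ 7 by omega] using gA l hl
          · rw [← garr a ha]
            funext j k
            simp [Mem.setReg, Mem.write, ha]
          · simpa [Mem.setReg, Mem.write, NatExp.eval, g6, hi.ne] using gd i hi j hj
          · by_cases hjm : j = m
            · simp [Mem.setReg, Mem.write, NatExp.eval, g6, h7, hjm, candidate, RealExp.eval, garr,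
                g0, h0]
            · simpa [Mem.setReg, Mem.write, NatExp.eval, g6, h7, hjm] using ge j (by omega))
      refine ⟨υ, r, (h7 6 (by norm_num)).trans h6, (h7 0 (by norm_num)).trans h0,
        fun l hl => ?_, f1, fun i hi j hj => ?_⟩
      · simpa [Mem.setReg, show l ≠ 6 by omega, h7 l (by omega)] using hA l hl
      · rcases Nat.lt_succ_iff_lt_or_eq.1 hi with hi | rfl
        · exact f2 i hi j hj
        · exact f3 j (by rw [h0]; exact hj))
  exact ⟨τ, h1, h2⟩

/-- Set register `1` to the number of grid points `2 s² + 1`, register `3` to the number of entries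
`s²`, and register `2` to the number of candidates. -/
def initProgram : Program :=
  .seq (.setReg 3 (.mul (.reg 0) (.reg 0))) <|
  .seq (.setReg 1 (.add (.mul (.const 2) (.reg 3)) (.const 1))) <|
  .seq (.setReg 2 (.const 1)) <|
  .forLoop 6 3 (.setReg 2 (.mul (.reg 2) (.reg 1)))

theorem runs_initProgram (σ : Mem) :
    ∃ τ, Runs initProgram σ τ ∧ τ.arr = σ.arr ∧ τ.reg 0 = σ.reg 0 ∧
      τ.reg 3 = σ.reg 0 * σ.reg 0 ∧ τ.reg 1 = 2 * (σ.reg 0 * σ.reg 0) + 1 ∧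
      τ.reg 2 = (2 * (σ.reg 0 * σ.reg 0) + 1) ^ (σ.reg 0 * σ.reg 0) := by
  set s := σ.reg 0 with hs
  obtain ⟨τ, h1, h2⟩ := Program.runs_forLoop (k := 6) (r := 3)
    (P := .setReg 2 (.mul (.reg 2) (.reg 1)))
    (fun n τ => τ.arr = σ.arr ∧ τ.reg 0 = s ∧ τ.reg 3 = s * s ∧
      τ.reg 1 = 2 * (s * s) + 1 ∧ τ.reg 2 = (2 * (s * s) + 1) ^ n)
    (σ := ((σ.setReg 3 (s * s)).setReg 1 (2 * (s * s) + 1)).setReg 2 1) (by norm_num)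
    ⟨rfl, by simp [Mem.setReg, hs], by simp [Mem.setReg], by simp [Mem.setReg],
      by simp [Mem.setReg]⟩ (by
      rintro i hi τ h6 h3 ⟨g1, g2, g3, g4, g5⟩
      refine ⟨_, Runs.setReg _ _ _, by simpa [Mem.setReg] using h6,
        by simpa [Mem.setReg] using h3, g1, by simpa [Mem.setReg] using g2,
        by simpa [Mem.setReg] using g3, by simpa [Mem.setReg] using g4, ?_⟩
      simp [Mem.setReg, NatExp.eval, g4, g5, pow_succ])
  refine ⟨τ, Runs.seq (Runs.setReg _ _ _) (Runs.seq (Runs.setReg _ _ _)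
    (Runs.seq (Runs.setReg _ _ _) ?_)), ?_⟩
  · convert h1 using 1; simp [Mem.setReg, NatExp.eval, hs]
  · simpa [Mem.setReg] using h2

/-- Try all candidates on the grid, and output the last one that is accepted. -/
def searchProgram (b κ : ℕ) : Program :=
  .seq initProgram <| .forLoop 4 2 <| .seq decodeProgram <| .seq (checkProgram b κ) <|
    .cond (.natLt (.reg 5) (.const 1)) copyProgram .skip

theorem block_congr {s : ℕ} {f g : ℕ → ℕ → ℝ} (h : ∀ i < s, ∀ j < s, f i j = g i j) :
    block s f = block s g := by
  ext i j
  exact h i i.2 j j.2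

theorem unroll_congr {s : ℕ} {v w : ℕ → ℝ} (h : ∀ p < s * s, v p = w p) :
    unroll s v = unroll s w :=
  block_congr fun i hi j hj => h _ (by nlinarith)

/-- The invariant says that array `1` holds an accepted matrix as soon as some candidate tried so
far was accepted. A later success only replaces it by another accepted matrix, which is harmless
because every accepted matrix will be shown to be good. -/
theorem runs_searchProgram (b κ s : ℕ) (M : Matrix (Fin s) (Fin s) ℝ) :
    ∃ τ, Runs (searchProgram b κ) (Mem.input s M) τ ∧
      ∀ N < (2 * (s * s) + 1) ^ (s * s),
        Accepts (scale b s) κ M (unroll s (gridEntry s (2 * (s * s) + 1) N)) →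
        Accepts (scale b s) κ M (τ.output s) := by
  obtain ⟨σ, r0, ha, h0, h3, h1, h2⟩ := runs_initProgram (Mem.input s M)
  have hin : (Mem.input s M).reg 0 = s := rfl
  rw [hin] at h0 h3 h1 h2
  have hM : block s (σ.arr 0) = M := by
    ext i j
    simp [block, ha, Mem.input]
  obtain ⟨τ, h4, h5, h6, h7⟩ := Program.runs_forLoop (k := 4) (r := 2)
    (P := .seq decodeProgram <| .seq (checkProgram b κ) <|
      .cond (.natLt (.reg 5) (.const 1)) copyProgram .skip)
    (fun n τ => (∀ l < 4, τ.reg l = σ.reg l) ∧ τ.arr 0 = σ.arr 0 ∧ ∀ N < n,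
        Accepts (scale b s) κ M (unroll s (gridEntry s (2 * (s * s) + 1) N)) →
        Accepts (scale b s) κ M (block s (τ.arr 1))) (σ := σ) (by norm_num)
    ⟨fun l hl => by simp [Mem.setReg, show l ≠ 4 by omega], rfl, by simp⟩ (by
      rintro n hn τ g4 g2 ⟨gA, garr, gd⟩
      obtain ⟨τ₁, r1, f1, a1, d1⟩ := runs_decodeProgram τ
        (by rw [gA 1 (by norm_num), h1]; omega)
      rw [gA 0 (by norm_num), gA 1 (by norm_num), gA 3 (by norm_num), h0, h1, h3, g4] at d1
      obtain ⟨τ₂, r2, A2, c2⟩ := runs_checkProgram b κ τ₁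
      rw [f1 0 (by norm_num), gA 0 (by norm_num), h0, a1 0 (by norm_num), garr, hM,
        unroll_congr d1] at c2
      have e2 : ∀ l < 5, τ₂.reg l = τ.reg l := fun l hl => by
        rw [A2.reg l (by omega) (by omega), f1 l (by omega)]
      by_cases hc : τ₂.reg 5 = 0
      · obtain ⟨τ₃, r3, f3, a3, d3⟩ := runs_copyProgram τ₂
        refine ⟨τ₃, Runs.seq r1 (Runs.seq r2 (Runs.condTrue ?_ r3)), ?_, ?_, fun l hl => ?_, ?_,
          fun N hN h => ?_⟩
        · simp [Test.holds, NatExp.eval, hc]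
        · rw [f3 4 (by norm_num), e2 4 (by norm_num), g4]
        · rw [f3 2 (by norm_num), e2 2 (by norm_num), g2]
        · simp only [Mem.setReg, show l ≠ 4 by omega, if_false]
          rw [f3 l (by omega), e2 l (by omega), gA l hl]
        · simp only [Mem.setReg]
          rw [a3 0 (by norm_num), A2.arr, a1 0 (by norm_num), garr]
        · have := c2.1 hc
          convert this using 1
          refine block_congr fun i hi j hj => ?_
          simp only [Mem.setReg]
          have e0 : τ₂.reg 0 = s := by rw [e2 0 (by norm_num), gA 0 (by norm_num), h0]
          rw [e0] at d3
          rw [d3 i hi j hj, A2.arr, d1 _ (by nlinarith)]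
      · refine ⟨τ₂, Runs.seq r1 (Runs.seq r2 (Runs.condFalse ?_ (Runs.skip _))), ?_, ?_,
          fun l hl => ?_, ?_, fun N hN h => ?_⟩
        · simpa [Test.holds, NatExp.eval] using hc
        · rw [e2 4 (by norm_num), g4]
        · rw [e2 2 (by norm_num), g2]
        · simp only [Mem.setReg, show l ≠ 4 by omega, if_false]
          rw [e2 l (by omega), gA l hl]
        · simp only [Mem.setReg]
          rw [A2.arr, a1 0 (by norm_num), garr]
        · simp only [Mem.setReg]
          rw [A2.arr, a1 1 (by norm_num)]
          rcases Nat.lt_succ_iff_lt_or_eq.1 hN with hN | rfl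
          · exact gd N hN h
          · exact absurd (c2.2 h) hc)
  refine ⟨τ, Runs.seq r0 h4, ?_⟩
  rw [h2] at h7
  exact h7

/-- A grid matrix is a function from `s²` cells to `2 s² + 1` values, hence the digit sequence of a
number in base `2 s² + 1`. -/
theorem IsGrid.exists_eq_unroll {s : ℕ} {V : Matrix (Fin s) (Fin s) ℝ} (hV : IsGrid V) :
    ∃ N < (2 * (s * s) + 1) ^ (s * s), unroll s (gridEntry s (2 * (s * s) + 1) N) = V := by
  choose d hd hdV using hV
  let f : Fin (s * s) → Fin (2 * (s * s) + 1) := fun p =>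
    ⟨d (finProdFinEquiv.symm p).1 (finProdFinEquiv.symm p).2, by
      have := hd (finProdFinEquiv.symm p).1 (finProdFinEquiv.symm p).2
      omega⟩
  refine ⟨finFunctionFinEquiv f, (finFunctionFinEquiv f).2, ?_⟩
  ext i j
  have h1 : finFunctionFinEquiv.symm (finFunctionFinEquiv f) (finProdFinEquiv (i, j)) =
      f (finProdFinEquiv (i, j)) := by rw [Equiv.symm_apply_apply]
  have h2 := congrArg Fin.val h1
  have h3 : ((finProdFinEquiv (i, j) : Fin (s * s)) : ℕ) = i * s + j := by
    simp [finProdFinEquiv]; ring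
  have h4 : ((finFunctionFinEquiv f : Fin _) : ℕ) / (2 * (s * s) + 1) ^ ((i : ℕ) * s + j) %
      (2 * (s * s) + 1) = d i j := by
    rw [← h3]
    refine Eq.trans ?_ (h2.trans ?_)
    · rfl
    · simp [f]
  simp only [unroll, block, Matrix.of_apply, gridEntry, h4, hdV]

theorem exists_search_program (b κ : ℕ) :
    ∃ (P : Program) (alg : (s : ℕ) → Matrix (Fin s) (Fin s) ℝ → Matrix (Fin s) (Fin s) ℝ),
      P.Computes alg ∧ ∀ s M, (∃ V, IsGrid V ∧ Accepts (scale b s) κ M V) →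
        Accepts (scale b s) κ M (alg s M) := by
  choose τ hτ hacc using runs_searchProgram b κ
  refine ⟨searchProgram b κ, fun s M => (τ s M).output s, fun s M => ⟨τ s M, hτ s M, rfl⟩, ?_⟩
  rintro s M ⟨V, hV, hA⟩
  obtain ⟨N, hN, rfl⟩ := hV.exists_eq_unroll
  exact hacc s M N hN hA

/-! ### Sparse matrices without coincidences are determined by their Gram matrix -/

open Classical in
/-- The typical behaviour of a sparse random matrix, at scale `x`. -/
structure IsTypical {s : ℕ} (x : ℝ) (κ c : ℕ) (A : Matrix (Fin s) (Fin s) ℝ) : Prop where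
  bound : ∀ i j, |A i j| ≤ x
  row_card : ∀ i, ((Finset.univ.filter fun l => A i l ≠ 0).card : ℝ) ≤ x ^ (κ + 12)
  col_large : ∀ l, x ^ (κ + 9) ≤ ((Finset.univ.filter fun j => 2 ≤ |A j l|).card : ℝ)
  row_overlap : ∀ i i', i ≠ i' →
    ((Finset.univ.filter fun l => A i l ≠ 0 ∧ A i' l ≠ 0).card : ℝ) ≤ x
  detour : ∀ i l, ((Finset.univ.filter fun j =>
    j ≠ i ∧ A j l ≠ 0 ∧ ∃ l', l' ≠ l ∧ A i l' ≠ 0 ∧ A j l' ≠ 0).card : ℝ) ≤ x ^ κ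
  common : ∀ F : Finset (Fin s), F.card = 2 * c → ((Finset.univ.filter fun j =>
    j ∉ F ∧ c ≤ (Finset.univ.filter fun l => A j l ≠ 0 ∧ ∃ i ∈ F, A i l ≠ 0).card).card : ℝ) ≤ x ^ κ

variable {s κ c : ℕ} {x : ℝ} {A M V : Matrix (Fin s) (Fin s) ℝ}

theorem gram_apply_eq (i j l : Fin s) (h : ∀ l', l' ≠ l → A i l' = 0 ∨ A j l' = 0) :
    (A * A.transpose) i j = A i l * A j l := by
  rw [Matrix.mul_apply, Finset.sum_eq_single l]
  · rfl
  · intro l' _ hl'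
    rcases h l' hl' with h | h <;> simp [h]
  · simp

theorem gram_apply_eq_zero (i j : Fin s) (h : ∀ l, A i l = 0 ∨ A j l = 0) :
    (A * A.transpose) i j = 0 := by
  rw [Matrix.mul_apply]
  exact Finset.sum_eq_zero fun l _ => by rcases h l with h | h <;> simp [h]

open Classical in
/-- A set of rows most of whose pairs meet has a large part in one column. -/
theorem IsTypical.exists_column (hA : IsTypical x κ c A) (hx : 1 ≤ x) (hxc : 8 * c ^ 2 + 8 ≤ x)
    (J : Finset (Fin s)) (hJ : x ^ (κ + 9) ≤ J.card)
    (hadj : ∀ i ∈ J, ((J.filter fun j => ∀ l, A i l = 0 ∨ A j l = 0).card : ℝ) ≤ x ^ (κ + 1)) :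
    ∃ l, x ^ (κ + 5) < (J.filter fun j => A j l ≠ 0).card := by
  by_contra! hsmall
  have hx0 : 0 < x := by linarith
  have hc0 : (0 : ℝ) ≤ c := by positivity
  have hck : (2 * c : ℝ) ≤ x := by nlinarith [sq_nonneg ((c : ℝ) - 1)]
  -- Greedy choice of rows of `J`, no three of which share a column. The set `L` of columns already
  -- used twice has at most `(2 c)² x` elements by `row_overlap`, and each holds at most `x ^ (κ +
  -- 5)` rows of `J`; so some row of `J` is new and avoids `L`.
  have key : ∀ n ≤ 2 * c, ∃ F ⊆ J, F.card = n ∧ ∀ l, (F.filter fun i => A i l ≠ 0).card ≤ 2 := by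
    intro n
    induction n with
    | zero => exact fun _ => ⟨∅, by simp, by simp, by simp⟩
    | succ n ih =>
      intro hn
      obtain ⟨F, hFJ, hFn, hF2⟩ := ih (by omega)
      set L : Finset (Fin s) := F.offDiag.biUnion fun p =>
        Finset.univ.filter fun l => A p.1 l ≠ 0 ∧ A p.2 l ≠ 0 with hL
      have hLcard : (L.card : ℝ) ≤ (2 * c) ^ 2 * x := by
        calc (L.card : ℝ) ≤ ∑ p ∈ F.offDiag,
              ((Finset.univ.filter fun l => A p.1 l ≠ 0 ∧ A p.2 l ≠ 0).card : ℝ) := by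
              exact_mod_cast Finset.card_biUnion_le
          _ ≤ ∑ p ∈ F.offDiag, x := Finset.sum_le_sum fun p hp =>
              hA.row_overlap _ _ (Finset.mem_offDiag.1 hp).2.2
          _ = F.offDiag.card * x := by simp
          _ ≤ (2 * c) ^ 2 * x := by
              gcongr
              rw [Finset.offDiag_card, hFn]
              have h1 : n * n - n ≤ (2 * c) ^ 2 := by
                have : n * n ≤ (2 * c) * (2 * c) := Nat.mul_le_mul (by omega) (by omega)
                rw [sq]; omega
              exact_mod_cast h1
      set E : Finset (Fin s) := F ∪ L.biUnion fun l => J.filter fun j => A j l ≠ 0 with hE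
      have hEcard : (E.card : ℝ) < J.card := by
        have h1 : (E.card : ℝ) ≤ F.card + ∑ l ∈ L, ((J.filter fun j => A j l ≠ 0).card : ℝ) := by
          exact_mod_cast (Finset.card_union_le _ _).trans
            (Nat.add_le_add_left Finset.card_biUnion_le _)
        have h2 : ∑ l ∈ L, ((J.filter fun j => A j l ≠ 0).card : ℝ) ≤ L.card * x ^ (κ + 5) := by
          rw [← nsmul_eq_mul]
          exact Finset.sum_le_card_nsmul _ _ _ fun l _ => hsmall l
        have h3 : (F.card : ℝ) ≤ x := by
          rw [hFn]
          refine le_trans ?_ hck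
          exact_mod_cast (by omega : n ≤ 2 * c)
        have h4 : (1 : ℝ) ≤ x ^ κ := one_le_pow₀ hx
        have h5 : x ≤ x ^ 6 := le_self_pow₀ hx (by norm_num)
        have h6 : (L.card : ℝ) * x ^ (κ + 5) ≤ (2 * c) ^ 2 * x * x ^ (κ + 5) := by gcongr
        have h7 : x ≤ x ^ κ * x ^ 6 := h5.trans (le_mul_of_one_le_left (by positivity) h4)
        have h8 : (4 * (c : ℝ) ^ 2 + 1) < x ^ 3 := by
          have : x ≤ x ^ 3 := le_self_pow₀ hx (by norm_num)
          nlinarith [sq_nonneg (c : ℝ)]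
        calc (E.card : ℝ) ≤ x ^ κ * x ^ 6 * (4 * (c : ℝ) ^ 2 + 1) := by
              have e : (2 * (c : ℝ)) ^ 2 * x * x ^ (κ + 5) = x ^ κ * x ^ 6 * (4 * c ^ 2) := by ring
              linarith
          _ < x ^ κ * x ^ 6 * x ^ 3 := by gcongr
          _ = x ^ (κ + 9) := by ring
          _ ≤ J.card := hJ
      obtain ⟨j, hjJ, hjE⟩ := Finset.exists_mem_notMem_of_card_lt_card (by exact_mod_cast hEcard)
      have hjF : j ∉ F := fun h => hjE (Finset.mem_union_left _ h)
      refine ⟨insert j F, Finset.insert_subset hjJ hFJ, by simp [hjF, hFn], fun l => ?_⟩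
      rw [Finset.filter_insert]
      split_ifs with hjl
      · have hlL : l ∉ L := fun h => hjE (Finset.mem_union_right _
          (Finset.mem_biUnion.2 ⟨l, h, Finset.mem_filter.2 ⟨hjJ, hjl⟩⟩))
        have : (F.filter fun i => A i l ≠ 0).card ≤ 1 := by
          rw [Finset.card_le_one]
          intro a ha b hb
          by_contra hab
          rw [Finset.mem_filter] at ha hb
          exact hlL (Finset.mem_biUnion.2 ⟨(a, b), Finset.mem_offDiag.2 ⟨ha.1, hb.1, hab⟩,
            by simp [ha.2, hb.2]⟩)
        exact (Finset.card_insert_le _ _).trans (by omega)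
      · exact hF2 l
  obtain ⟨F, hFJ, hFn, hF2⟩ := key (2 * c) le_rfl
  -- A row of `J` outside `G` meets all `2 c` rows of `F`. One column accounts for at most two of
  -- them, so at least `c` columns are involved, and `common` allows only `x ^ κ` such rows. As `G`
  -- is small too, `J` would be too small.
  set G : Finset (Fin s) := F ∪ F.biUnion fun i => J.filter fun j => ∀ l, A i l = 0 ∨ A j l = 0
    with hG
  have hGcard : (G.card : ℝ) ≤ x + x * x ^ (κ + 1) := by
    have h1 : (G.card : ℝ) ≤ F.card +
        ∑ i ∈ F, ((J.filter fun j => ∀ l, A i l = 0 ∨ A j l = 0).card : ℝ) := by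
      exact_mod_cast (Finset.card_union_le _ _).trans
        (Nat.add_le_add_left Finset.card_biUnion_le _)
    have h2 : ∑ i ∈ F, ((J.filter fun j => ∀ l, A i l = 0 ∨ A j l = 0).card : ℝ) ≤
        F.card * x ^ (κ + 1) := by
      rw [← nsmul_eq_mul]
      exact Finset.sum_le_card_nsmul _ _ _ fun i hi => hadj i (hFJ hi)
    have h3 : (F.card : ℝ) ≤ x := by rw [hFn]; push_cast; exact hck
    have h4 : (F.card : ℝ) * x ^ (κ + 1) ≤ x * x ^ (κ + 1) := by gcongr
    linarith
  have hcommon := hA.common F hFn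
  have hsub : J \ G ⊆ Finset.univ.filter fun j =>
    j ∉ F ∧ c ≤ (Finset.univ.filter fun l => A j l ≠ 0 ∧ ∃ i ∈ F, A i l ≠ 0).card := by
    intro j hj
    rw [Finset.mem_sdiff, hG, Finset.mem_union, not_or] at hj
    obtain ⟨hjJ, hjF, hjG⟩ := hj
    refine Finset.mem_filter.2 ⟨Finset.mem_univ _, hjF, ?_⟩
    have hcov : F ⊆ (Finset.univ.filter fun l => A j l ≠ 0 ∧ ∃ i ∈ F, A i l ≠ 0).biUnion
        fun l => F.filter fun i => A i l ≠ 0 := by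
      intro i hi
      have : ¬ ∀ l, A i l = 0 ∨ A j l = 0 := fun h =>
        hjG (Finset.mem_biUnion.2 ⟨i, hi, Finset.mem_filter.2 ⟨hjJ, h⟩⟩)
      push Not at this
      obtain ⟨l, hl, hl'⟩ := this
      exact Finset.mem_biUnion.2 ⟨l, Finset.mem_filter.2 ⟨Finset.mem_univ _, hl', i, hi, hl⟩,
        Finset.mem_filter.2 ⟨hi, hl⟩⟩
    have h1 := (Finset.card_le_card hcov).trans
      (Finset.card_biUnion_le_card_mul _ _ 2 fun l _ => hF2 l)
    omega
  have h1 : (J.card : ℝ) ≤ (J \ G).card + G.card := by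
    exact_mod_cast (by have := Finset.le_card_sdiff G J; omega : J.card ≤ (J \ G).card + G.card)
  have h2 : ((J \ G).card : ℝ) ≤ x ^ κ := le_trans (by exact_mod_cast Finset.card_le_card hsub) hcommon
  have h3 : (1 : ℝ) ≤ x ^ κ := one_le_pow₀ hx
  have h4 : x ≤ x ^ 2 := le_self_pow₀ hx (by norm_num)
  have h5 : 1 ≤ x ^ 2 := one_le_pow₀ hx
  have h6 : x ^ 2 * 3 < x ^ 9 := by
    have : x ≤ x ^ 7 := le_self_pow₀ hx (by norm_num)
    have h8 : 8 ≤ x := by nlinarith [sq_nonneg (c : ℝ)]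
    calc x ^ 2 * 3 < x ^ 2 * x ^ 7 := by gcongr; linarith
      _ = x ^ 9 := by ring
  have : x + x * x ^ (κ + 1) + x ^ κ < x ^ (κ + 9) := by
    have e1 : x * x ^ (κ + 1) = x ^ κ * x ^ 2 := by ring
    have e2 : x ^ (κ + 9) = x ^ κ * x ^ 9 := by ring
    rw [e1, e2]
    have : x ≤ x ^ κ * x ^ 2 := h4.trans (le_mul_of_one_le_left (by positivity) h3)
    have : x ^ κ ≤ x ^ κ * x ^ 2 := le_mul_of_one_le_right (by positivity) h5
    have : x ^ κ * (x ^ 2 * 3) < x ^ κ * x ^ 9 := by gcongr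
    linarith
  linarith

/-! ### From products of entries to a column, and recovery from acceptance. -/

theorem units_cast_mul_self (σ : ℤˣ) : ((σ : ℤ) : ℝ) * ((σ : ℤ) : ℝ) = 1 := by
  rcases Int.units_eq_one_or σ with rfl | rfl <;> simp

theorem abs_units_cast (σ : ℤˣ) : |((σ : ℤ) : ℝ)| = 1 := by
  rcases Int.units_eq_one_or σ with rfl | rfl <;> simp

open Classical in
/-- If the products `v i * v j` and `a i * a j` agree for most `j` in a set on which `v` is large,
then `v` and `a` agree up to the sign. -/
theorem exists_sign_close {ι : Type*} (U : Finset ι) (v a : ι → ℝ) {e x B : ℝ} (he : 0 ≤ e)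
    (he1 : e ≤ 1) (hx : 1 ≤ x) (ha : ∀ i, |a i| ≤ x) (hv : ∀ j ∈ U, 1 ≤ |v j|) (hU : U.Nonempty)
    (hbad : ∀ i, ((U.filter fun j => ¬ |v i * v j - a i * a j| ≤ e).card : ℝ) ≤ B)
    (hB : 2 * B < U.card) :
    ∃ σ : ℤˣ, ∀ i, |v i - ((σ : ℤ) : ℝ) * a i| ≤ 6 * x ^ 4 * e := by
  -- As `2 B < |U|`, the exceptional sets of two indices do not cover `U`.
  have pick : ∀ i i', ∃ j ∈ U, |v i * v j - a i * a j| ≤ e ∧ |v i' * v j - a i' * a j| ≤ e := by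
    intro i i'
    have hlt : ((U.filter fun j => ¬ |v i * v j - a i * a j| ≤ e) ∪
        (U.filter fun j => ¬ |v i' * v j - a i' * a j| ≤ e)).card < U.card := by
      have h1 : ((((U.filter fun j => ¬ |v i * v j - a i * a j| ≤ e) ∪
        (U.filter fun j => ¬ |v i' * v j - a i' * a j| ≤ e)).card : ℕ) : ℝ) ≤ B + B :=
        le_trans (by exact_mod_cast Finset.card_union_le _ _) (add_le_add (hbad i) (hbad i'))
      exact_mod_cast (by linarith : ((((U.filter fun j => ¬ |v i * v j - a i * a j| ≤ e) ∪
        (U.filter fun j => ¬ |v i' * v j - a i' * a j| ≤ e)).card : ℕ) : ℝ) < U.card)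
    obtain ⟨j, hj, hj'⟩ := Finset.exists_mem_notMem_of_card_lt_card hlt
    rw [Finset.mem_union, not_or, Finset.mem_filter, Finset.mem_filter] at hj'
    exact ⟨j, hj, by tauto, by tauto⟩
  have div_le : ∀ {w t r : ℝ}, 1 ≤ |w| → |w * t| ≤ r → |t| ≤ r := by
    intro w t r hw h
    rw [abs_mul] at h
    nlinarith [abs_nonneg t]
  obtain ⟨p, hp⟩ := hU
  obtain ⟨q, hq, hpq, -⟩ := pick p p
  obtain ⟨r, hr, hpr, hqr⟩ := pick p q
  -- Three pairwise compatible indices determine a square: `v p ^ 2 = (v p * v q) * (v p * v r) / (v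
  -- q * v r)`, and likewise for `a`. The denominator `v q * v r` is at least `1` in absolute value.
  have hsq : |v p ^ 2 - a p ^ 2| ≤ 4 * x ^ 2 * e := by
    refine div_le (w := v q * v r) ?_ ?_
    · rw [abs_mul]
      exact one_le_mul_of_one_le_of_one_le (hv q hq) (hv r hr)
    · have e1 : v q * v r * (v p ^ 2 - a p ^ 2) = a p * a q * (v p * v r - a p * a r) +
          a p * a r * (v p * v q - a p * a q) +
          (v p * v q - a p * a q) * (v p * v r - a p * a r) -
          a p * a p * (v q * v r - a q * a r) := by ring
      have hprod : ∀ i j, |a i * a j| ≤ x * x := fun i j => by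
        rw [abs_mul]; exact mul_le_mul (ha i) (ha j) (abs_nonneg _) (by linarith)
      have m1 : |a p * a q * (v p * v r - a p * a r)| ≤ x * x * e := by
        rw [abs_mul]; exact mul_le_mul (hprod _ _) hpr (abs_nonneg _) (by positivity)
      have m2 : |a p * a r * (v p * v q - a p * a q)| ≤ x * x * e := by
        rw [abs_mul]; exact mul_le_mul (hprod _ _) hpq (abs_nonneg _) (by positivity)
      have m3 : |(v p * v q - a p * a q) * (v p * v r - a p * a r)| ≤ e * e := by
        rw [abs_mul]; exact mul_le_mul hpq hpr (abs_nonneg _) he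
      have m4 : |a p * a p * (v q * v r - a q * a r)| ≤ x * x * e := by
        rw [abs_mul]; exact mul_le_mul (hprod _ _) hqr (abs_nonneg _) (by positivity)
      have m5 : e * e ≤ x * x * e := by
        have : 1 ≤ x * x := by nlinarith
        gcongr
        linarith
      rw [e1]
      rw [abs_le] at *
      constructor <;> linarith [m1.1, m1.2, m2.1, m2.2, m3.1, m3.2, m4.1, m4.2]
  -- The factors `v p + a p` and `v p - a p` cannot both be below `1` in absolute value because `|v
  -- p| ≥ 1`; the other factor then inherits the bound for the product.
  obtain ⟨σ, hσ⟩ : ∃ σ : ℤˣ, |v p - ((σ : ℤ) : ℝ) * a p| ≤ 4 * x ^ 2 * e := by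
    have e1 : v p ^ 2 - a p ^ 2 = (v p + a p) * (v p - a p) := by ring
    have h2 : 2 ≤ |v p + a p| + |v p - a p| := by
      have := abs_add_le (v p + a p) (v p - a p)
      have e2 : v p + a p + (v p - a p) = 2 * v p := by ring
      rw [e2, abs_mul, abs_two] at this
      linarith [hv p hp]
    rcases le_total 1 |v p + a p| with h | h
    · refine ⟨1, ?_⟩
      simp only [Units.val_one, Int.cast_one, one_mul]
      exact div_le h (by rw [← e1]; exact hsq)
    · refine ⟨-1, ?_⟩
      simp only [Units.val_neg, Units.val_one, Int.cast_neg, Int.cast_one, neg_mul, one_mul,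
        sub_neg_eq_add]
      exact div_le (w := v p - a p) (by linarith) (by rw [mul_comm, ← e1]; exact hsq)
  refine ⟨σ, fun i => ?_⟩
  set t : ℝ := ((σ : ℤ) : ℝ) with ht
  have htt : t * t = 1 := units_cast_mul_self σ
  have htabs : |t| = 1 := abs_units_cast σ
  -- The sign passes from `p` to `j` and from `j` to `i`. Each passage multiplies the error by `x`
  -- and adds `e`, whence `4 x²`, `5 x³`, `6 x⁴`.
  obtain ⟨j, hj, hij, hpj⟩ := pick i p
  have hvj : |v j - t * a j| ≤ 5 * x ^ 3 * e := by
    refine div_le (hv p hp) ?_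
    have e1 : v p * (v j - t * a j) = (v p * v j - a p * a j) - t * a j * (v p - t * a p) +
      (1 - t * t) * (a p * a j) := by ring
    have m1 : |t * a j * (v p - t * a p)| ≤ x * (4 * x ^ 2 * e) := by
      rw [abs_mul, abs_mul, htabs, one_mul]
      exact mul_le_mul (ha j) hσ (abs_nonneg _) (by linarith)
    have m2 : e ≤ x ^ 3 * e := le_mul_of_one_le_left he (one_le_pow₀ hx)
    rw [e1, htt]
    rw [abs_le] at *
    constructor <;> linarith [m1.1, m1.2]
  refine div_le (hv j hj) ?_
  have e1 : v j * (v i - t * a i) = (v i * v j - a i * a j) - t * a i * (v j - t * a j) +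
      (1 - t * t) * (a i * a j) := by ring
  have m1 : |t * a i * (v j - t * a j)| ≤ x * (5 * x ^ 3 * e) := by
    rw [abs_mul, abs_mul, htabs, one_mul]
    exact mul_le_mul (ha i) hvj (abs_nonneg _) (by linarith)
  have m2 : e ≤ x ^ 4 * e := le_mul_of_one_le_left he (one_le_pow₀ hx)
  rw [e1, htt]
  rw [abs_le] at *
  constructor <;> linarith [m1.1, m1.2]

/-- Outside of the exceptional rows, the entries of the Gram matrix come from a single column. -/
theorem gram_eq_of_not_detour {i j l : Fin s} (hj : A j l ≠ 0)
    (h : ¬ (j ≠ i ∧ A j l ≠ 0 ∧ ∃ l', l' ≠ l ∧ A i l' ≠ 0 ∧ A j l' ≠ 0)) (hji : j ≠ i) :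
    (A * A.transpose) i j = A i l * A j l := by
  refine gram_apply_eq i j l fun l' hl' => ?_
  by_contra! hne
  exact h ⟨hji, hj, l', hl', hne.1, hne.2⟩

/-- Every column of an accepted matrix is close to a column of `A`, up to the sign. -/
theorem IsTypical.column_close (hA : IsTypical x κ c A) (hx : 8 ≤ x) (hxc : 8 * c ^ 2 + 8 ≤ x)
    (hM : ∀ i j, |M i j - (A * A.transpose) i j| ≤ 1 / x ^ 11) (hV : Accepts x κ M V) (k : Fin s) :
    ∃ (l : Fin s) (σ : ℤˣ), ∀ i, |V i k - ((σ : ℤ) : ℝ) * A i l| ≤ 12 / x ^ 6 := by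
  classical
  have hx0 : 0 < x := by linarith
  have hx1 : 1 ≤ x := by linarith
  have hpow : 1 ≤ x ^ 10 := one_le_pow₀ hx1
  have h11 : 1 / x ^ 11 ≤ 1 / x ^ 10 := by gcongr; norm_num
  have h10 : 1 / x ^ 10 ≤ 1 / 8 := by
    have : x ≤ x ^ 10 := le_self_pow₀ hx1 (by norm_num)
    gcongr
    linarith
  have hκ : (1 : ℝ) ≤ x ^ κ := one_le_pow₀ hx1
  set J : Finset (Fin s) := Finset.univ.filter fun j => 1 ≤ |V j k| with hJ
  have hagree : ∀ i, ((J.filter fun j =>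
      1 / x ^ 10 < |M i j - V i k * V j k|).card : ℝ) ≤ x ^ (κ + 1) := by
    intro i
    refine le_trans ?_ (hV.agree k i)
    rw [hJ, Finset.filter_filter]
    refine Nat.cast_le.2 (Finset.card_le_card ?_)
    intro j
    simp only [Finset.mem_filter, Finset.mem_univ, true_and]
    rintro ⟨h1, h2⟩
    exact ⟨h1, by rwa [div_lt_iff₀' (by positivity)] at h2⟩
  -- If rows `i`, `j` of `J` do not meet, then `|M i j| ≤ x ^ (-11)` while `|V i k * V j k| ≥ 1`; so
  -- `j` is one of the few disagreements in row `i`.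
  obtain ⟨l, hl⟩ := hA.exists_column hx1 hxc J (hV.large k) (fun i hi => by
    refine le_trans ?_ (hagree i)
    refine Nat.cast_le.2 (Finset.card_le_card ?_)
    intro j hj
    rw [Finset.mem_filter] at hj ⊢
    refine ⟨hj.1, ?_⟩
    have h1 := hM i j
    rw [gram_apply_eq_zero i j hj.2, sub_zero] at h1
    have h2 : 1 ≤ |V i k * V j k| := by
      rw [abs_mul]
      exact one_le_mul_of_one_le_of_one_le (Finset.mem_filter.1 hi).2 (Finset.mem_filter.1 hj.1).2
    have h3 := abs_sub_abs_le_abs_sub (V i k * V j k) (M i j)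
    rw [abs_sub_comm] at h3
    linarith)
  set U := J.filter fun j => A j l ≠ 0 with hU
  have he : (2 / x ^ 10 : ℝ) ≤ 1 := by
    have : (2 / x ^ 10 : ℝ) = 2 * (1 / x ^ 10) := by ring
    linarith
  -- The exceptions for row `i` are `i` itself, the detours and the disagreements: at most `1 + x ^
  -- κ + x ^ (κ + 1)`. The tolerance adds that of the test, `x ^ (-10)`, and that of `M`, `x ^
  -- (-11)`.
  obtain ⟨σ, hσ⟩ := exists_sign_close U (fun i => V i k) (fun i => A i l) (e := 2 / x ^ 10)
    (x := x) (B := 3 * x ^ (κ + 1)) (by positivity) he hx1 (fun i => hA.bound i l)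
    (fun j hj => (Finset.mem_filter.1 (Finset.mem_filter.1 hj).1).2)
    (by
      rw [← Finset.card_pos]
      have : (0 : ℝ) < U.card := lt_trans (by positivity) hl
      exact_mod_cast this)
    (fun i => by
      have hsub : (U.filter fun j => ¬ |V i k * V j k - A i l * A j l| ≤ 2 / x ^ 10) ⊆
          {i} ∪ ((Finset.univ.filter fun j =>
            j ≠ i ∧ A j l ≠ 0 ∧ ∃ l', l' ≠ l ∧ A i l' ≠ 0 ∧ A j l' ≠ 0) ∪
            (J.filter fun j => 1 / x ^ 10 < |M i j - V i k * V j k|)) := by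
        intro j hj
        rw [Finset.mem_filter, hU, Finset.mem_filter] at hj
        obtain ⟨⟨hjJ, hjl⟩, hjbad⟩ := hj
        by_contra hne
        simp only [Finset.mem_union, not_or, Finset.mem_singleton] at hne
        obtain ⟨hji, hd, ha⟩ := hne
        rw [Finset.mem_filter] at hd ha
        have hd' := fun h => hd ⟨Finset.mem_univ _, h⟩
        have ha' : |M i j - V i k * V j k| ≤ 1 / x ^ 10 := by
          by_contra! h
          exact ha ⟨hjJ, h⟩
        have h1 := hM i j
        rw [gram_eq_of_not_detour hjl hd' hji] at h1
        apply hjbad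
        have e1 : (2 : ℝ) / x ^ 10 = 1 / x ^ 10 + 1 / x ^ 10 := by ring
        rw [e1]
        rw [abs_le] at *
        constructor <;> linarith [h1.1, h1.2, ha'.1, ha'.2]
      have h1 : ((U.filter fun j => ¬ |V i k * V j k - A i l * A j l| ≤ 2 / x ^ 10).card : ℝ) ≤
          1 + (((Finset.univ.filter fun j =>
            j ≠ i ∧ A j l ≠ 0 ∧ ∃ l', l' ≠ l ∧ A i l' ≠ 0 ∧ A j l' ≠ 0).card : ℝ) +
            ((J.filter fun j => 1 / x ^ 10 < |M i j - V i k * V j k|).card : ℝ)) := by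
        refine le_trans (Nat.cast_le.2 (Finset.card_le_card hsub)) ?_
        refine le_trans (Nat.cast_le.2 (Finset.card_union_le _ _)) ?_
        push_cast [Finset.card_singleton]
        gcongr
        exact_mod_cast Finset.card_union_le _ _
      have h2 := hA.detour i l
      have h3 := hagree i
      have h4 : x ^ κ ≤ x ^ (κ + 1) := pow_le_pow_right₀ hx1 (by omega)
      linarith)
    (by
      refine lt_of_le_of_lt ?_ hl
      have : x ^ (κ + 5) = x ^ (κ + 1) * x ^ 4 := by ring
      rw [this]
      have : x ≤ x ^ 4 := le_self_pow₀ hx1 (by norm_num)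
      have : 0 < x ^ (κ + 1) := by positivity
      nlinarith)
  refine ⟨l, σ, fun i => (hσ i).trans (le_of_eq ?_)⟩
  field_simp
  norm_num

/-- An injection of a finite set into itself is a permutation, which with the signs is a competitor
in the infimum. A sign may be moved across since it is its own inverse. -/
theorem recoveryDist_le {δ : ℝ} (hδ : 0 ≤ δ) (l : Fin s → Fin s) (hl : Function.Injective l)
    (σ : Fin s → ℤˣ) (h : ∀ i k, |V i k - ((σ k : ℤ) : ℝ) * A i (l k)| ≤ δ) :
    recoveryDist V A ≤ δ := by
  let p : Equiv.Perm (Fin s) := Equiv.ofBijective l (Finite.injective_iff_bijective.1 hl)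
  refine (ciInf_le (Set.finite_range _).bddBelow (p, fun j => σ (p.symm j))).trans ?_
  refine Real.iSup_le (fun ij => ?_) hδ
  obtain ⟨i, j⟩ := ij
  have h1 := h i (p.symm j)
  have h2 : l (p.symm j) = j := p.apply_symm_apply j
  rw [h2] at h1
  have h3 : (V * p.permMatrix ℝ) i j = V i (p.symm j) := by
    rw [Equiv.Perm.permMatrix, PEquiv.mul_toMatrix_toPEquiv]
    rfl
  rw [Matrix.sub_apply, Matrix.mul_diagonal, h3]
  set t : ℝ := ((σ (p.symm j) : ℤ) : ℝ) with ht
  have htt : t * t = 1 := units_cast_mul_self _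
  have htabs : |t| = 1 := abs_units_cast _
  calc |V i (p.symm j) * t - A i j| = |t * (V i (p.symm j) - t * A i j)| := by
        congr 1; linear_combination A i j * htt
    _ = |V i (p.symm j) - t * A i j| := by rw [abs_mul, htabs, one_mul]
    _ ≤ δ := h1

/-- Accepted matrices recover `A`. -/
theorem IsTypical.recoveryDist_le (hA : IsTypical x κ c A) (hx : 8 ≤ x) (hxc : 8 * c ^ 2 + 8 ≤ x)
    (hM : ∀ i j, |M i j - (A * A.transpose) i j| ≤ 1 / x ^ 11) (hV : Accepts x κ M V) :
    recoveryDist V A ≤ 12 / x ^ 6 := by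
  choose l σ h using hA.column_close hx hxc hM hV
  refine SparseICA.recoveryDist_le (by positivity) l ?_ σ fun i k => h k i
  intro k k' hkk
  by_contra hne
  -- If both columns were near the same column of `A` up to sign, their absolute values would differ
  -- by at most `1/4`, but at row `j` they differ by more than `1/2`.
  obtain ⟨j, hj, hj'⟩ := hV.separated k k' hne
  have h1 := h k j
  have h2 := h k' j
  have habs : ∀ τ : ℤˣ, |((τ : ℤ) : ℝ) * A j (l k)| = |A j (l k)| := fun τ => by
    rw [abs_mul, abs_units_cast, one_mul]
  have h3 := abs_sub_abs_le_abs_sub (V j k) (((σ k : ℤ) : ℝ) * A j (l k))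
  have h4 := abs_sub_abs_le_abs_sub (((σ k' : ℤ) : ℝ) * A j (l k')) (V j k')
  rw [← hkk] at h2 h4
  rw [abs_sub_comm] at h4
  rw [habs] at h3 h4
  have h5 : 12 / x ^ 6 ≤ 1 / 8 := by
    rw [div_le_div_iff₀ (by positivity) (by norm_num)]
    have : (8 : ℝ) ^ 6 ≤ x ^ 6 := by gcongr
    norm_num at this
    linarith
  linarith

/-- The rounding of `A` to the grid is accepted. -/
theorem IsTypical.exists_accepts (hA : IsTypical x κ c A) (hx : 8 ≤ x) (hxs : x ^ 20 ≤ s)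
    (hM : ∀ i j, |M i j - (A * A.transpose) i j| ≤ 1 / x ^ 11) :
    ∃ V, IsGrid V ∧ Accepts x κ M V := by
  classical
  have hx0 : 0 < x := by linarith
  have hx1 : 1 ≤ x := by linarith
  have hκ : (1 : ℝ) ≤ x ^ κ := one_le_pow₀ hx1
  have hs0 : (0 : ℝ) < s := lt_of_lt_of_le (by positivity) hxs
  have hxs' : x ≤ s := (le_self_pow₀ hx1 (by norm_num)).trans hxs
  -- The shift by `s ≥ x` makes the rounded quantity nonnegative, so the natural floor loses at most
  -- `1 / s ≤ x ^ (-20)`.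
  set V : Matrix (Fin s) (Fin s) ℝ := Matrix.of fun i j =>
    ((⌊(A i j + s) * s⌋₊ : ℕ) : ℝ) / s - s with hV
  have hVA : ∀ i j, |V i j - A i j| ≤ 1 / s := by
    intro i j
    have h0 : 0 ≤ (A i j + s) * s := by
      have := (abs_le.1 (hA.bound i j)).1
      exact mul_nonneg (by linarith) hs0.le
    have h1 := Nat.floor_le h0
    have h2 := Nat.lt_floor_add_one ((A i j + s) * s)
    simp only [hV, Matrix.of_apply]
    have h3 : ((⌊(A i j + s) * s⌋₊ : ℕ) : ℝ) / s ≤ A i j + s := by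
      rw [div_le_iff₀ hs0]; exact h1
    have h4 : A i j + s ≤ ((⌊(A i j + s) * s⌋₊ : ℕ) : ℝ) / s + 1 / s := by
      rw [← add_div, le_div_iff₀ hs0]; exact h2.le
    have h5 : 0 ≤ 1 / (s : ℝ) := by positivity
    rw [abs_le]
    constructor <;> linarith
  have hinv : 1 / (s : ℝ) ≤ 1 / x ^ 20 := by gcongr
  have hinv8 : 1 / (s : ℝ) ≤ 1 / 8 := by gcongr; linarith
  have hsupp : ∀ j k, 1 / 2 ≤ |V j k| → A j k ≠ 0 := by
    intro j k h h0
    have := hVA j k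
    rw [h0, sub_zero] at this
    linarith
  have hlarge : ∀ k, x ^ (κ + 9) ≤ ((Finset.univ.filter fun j => 1 ≤ |V j k|).card : ℝ) := by
    intro k
    -- Typicality counts entries of size at least `2`, so those of the rounding still exceed `1`.
    refine (hA.col_large k).trans (Nat.cast_le.2 (Finset.card_le_card ?_))
    intro j
    simp only [Finset.mem_filter, Finset.mem_univ, true_and]
    intro h
    have h1 := abs_sub_abs_le_abs_sub (A j k) (V j k)
    rw [abs_sub_comm] at h1
    linarith [hVA j k]
  refine ⟨V, fun i j => ⟨⌊(A i j + s) * s⌋₊, ?_, rfl⟩, hlarge, fun k i => ?_, fun k k' hkk => ?_⟩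
  · have : (A i j + s) * s ≤ ((2 * (s * s) : ℕ) : ℝ) := by
      have := (abs_le.1 (hA.bound i j)).2
      push_cast
      nlinarith
    exact Nat.floor_le_of_le this
  · have hsub : (Finset.univ.filter fun j =>
        1 ≤ |V j k| ∧ 1 < x ^ 10 * |M i j - V i k * V j k|) ⊆ {i} ∪ (Finset.univ.filter fun j =>
            j ≠ i ∧ A j k ≠ 0 ∧ ∃ l', l' ≠ k ∧ A i l' ≠ 0 ∧ A j l' ≠ 0) := by
      intro j hj
      rw [Finset.mem_filter] at hj
      obtain ⟨-, hj1, hj2⟩ := hj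
      by_contra hne
      simp only [Finset.mem_union, not_or, Finset.mem_singleton] at hne
      obtain ⟨hji, hd⟩ := hne
      rw [Finset.mem_filter] at hd
      have hd' := fun h => hd ⟨Finset.mem_univ _, h⟩
      have h1 := hM i j
      rw [gram_eq_of_not_detour (hsupp j k (by linarith)) hd' hji] at h1
      have e1 : M i j - V i k * V j k = (M i j - A i k * A j k) - (V i k - A i k) * A j k -
        (V j k - A j k) * A i k - (V i k - A i k) * (V j k - A j k) := by ring
      have m1 : |(V i k - A i k) * A j k| ≤ 1 / s * x := by
        rw [abs_mul]; exact mul_le_mul (hVA _ _) (hA.bound _ _) (abs_nonneg _) (by positivity)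
      have m2 : |(V j k - A j k) * A i k| ≤ 1 / s * x := by
        rw [abs_mul]; exact mul_le_mul (hVA _ _) (hA.bound _ _) (abs_nonneg _) (by positivity)
      have m3 : |(V i k - A i k) * (V j k - A j k)| ≤ 1 / s * x := by
        rw [abs_mul]; exact mul_le_mul (hVA _ _) ((hVA _ _).trans (by linarith)) (abs_nonneg _)
          (by positivity)
      have m4 : 1 / s * x ≤ 1 / x ^ 11 := by
        calc 1 / s * x ≤ 1 / x ^ 20 * x := by gcongr
          _ = 1 / x ^ 19 := by field_simp
          _ ≤ 1 / x ^ 11 := by gcongr; norm_num [hx1]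
      have m5 : |M i j - V i k * V j k| ≤ 4 * (1 / x ^ 11) := by
        rw [e1]
        rw [abs_le] at *
        constructor <;> linarith [m1.1, m1.2, m2.1, m2.2, m3.1, m3.2, h1.1, h1.2]
      have m6 : x ^ 10 * (4 * (1 / x ^ 11)) = 4 / x := by field_simp
      have m7 : 4 / x ≤ 1 := by rw [div_le_one hx0]; linarith
      have : x ^ 10 * |M i j - V i k * V j k| ≤ x ^ 10 * (4 * (1 / x ^ 11)) := by gcongr
      linarith
    refine le_trans (Nat.cast_le.2 (Finset.card_le_card hsub)) ?_
    refine le_trans (Nat.cast_le.2 (Finset.card_union_le _ _)) ?_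
    push_cast [Finset.card_singleton]
    have h2 := hA.detour i k
    have h3 : x ^ (κ + 1) = x ^ κ * x := by ring
    nlinarith
  -- Without separation, every row where column `k` of `V` is large is nonzero in both columns `k`
  -- and `k'` of `A`. Relative to one such row, all others are detours, which are too few.
  · by_contra! hne
    have hmem : ∀ j, 1 ≤ |V j k| → A j k ≠ 0 ∧ A j k' ≠ 0 := fun j hj =>
      ⟨hsupp j k (by linarith), hsupp j k' (hne j hj)⟩
    have hl := hlarge k
    have hl9 : (8 : ℝ) * x ^ κ ≤ x ^ (κ + 9) := by
      have e1 : x ^ (κ + 9) = x ^ 9 * x ^ κ := by ring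
      rw [e1]
      have : x ≤ x ^ 9 := le_self_pow₀ hx1 (by norm_num)
      gcongr
      linarith
    obtain ⟨i, hi⟩ : (Finset.univ.filter fun j => 1 ≤ |V j k|).Nonempty := by
      rw [← Finset.card_pos]
      have : (0 : ℝ) < (Finset.univ.filter fun j => 1 ≤ |V j k|).card := by linarith
      exact_mod_cast this
    have hi' := hmem i (Finset.mem_filter.1 hi).2
    have hsub : (Finset.univ.filter fun j => 1 ≤ |V j k|) ⊆ {i} ∪ (Finset.univ.filter fun j =>
            j ≠ i ∧ A j k ≠ 0 ∧ ∃ l', l' ≠ k ∧ A i l' ≠ 0 ∧ A j l' ≠ 0) := by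
      intro j hj
      have hj' := hmem j (Finset.mem_filter.1 hj).2
      simp only [Finset.mem_union, Finset.mem_singleton, Finset.mem_filter, Finset.mem_univ,
        true_and]
      by_cases hji : j = i
      · exact Or.inl hji
      · exact Or.inr ⟨hji, hj'.1, k', hkk.symm, hi'.2, hj'.2⟩
    have h1 : ((Finset.univ.filter fun j => 1 ≤ |V j k|).card : ℝ) ≤ 1 +
        ((Finset.univ.filter fun j =>
            j ≠ i ∧ A j k ≠ 0 ∧ ∃ l', l' ≠ k ∧ A i l' ≠ 0 ∧ A j l' ≠ 0).card : ℝ) := by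
      refine le_trans (Nat.cast_le.2 (Finset.card_le_card hsub)) ?_
      refine le_trans (Nat.cast_le.2 (Finset.card_union_le _ _)) ?_
      push_cast [Finset.card_singleton]
      rfl
    have h2 := hA.detour i k
    linarith

/-! ### Counting independent events -/

section Counting

variable {ι X : Type*} [Fintype ι] [MeasurableSpace X]

open Classical in
/-- The number of indices with a property. -/
noncomputable def tally {ι : Type*} [Fintype ι] (p : ι → Prop) : ℕ := (Finset.univ.filter p).card

theorem tally_eq {ι : Type*} [Fintype ι] (p : ι → Prop) [DecidablePred p] :
    tally p = (Finset.univ.filter p).card := by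
  unfold tally
  congr

theorem tally_mono {ι : Type*} [Fintype ι] {p q : ι → Prop} (h : ∀ i, p i → q i) :
    tally p ≤ tally q := by
  classical
  exact Finset.card_le_card (Finset.monotone_filter_right _ fun i _ => h i)

theorem measurable_tally {Ω : Type*} [MeasurableSpace Ω] (p : ι → Ω → Prop)
    (hp : ∀ i, MeasurableSet {ω | p i ω}) :
    Measurable fun ω => ((tally fun i => p i ω) : ℝ) := by
  classical
  have : (fun ω => ((tally fun i => p i ω) : ℝ)) =
      fun ω => ∑ i, Set.indicator {ω | p i ω} (fun _ => (1 : ℝ)) ω := by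
    funext ω
    rw [tally, Finset.card_filter]
    push_cast
    refine Finset.sum_congr rfl fun i _ => ?_
    by_cases h : p i ω <;> simp [h]
  rw [this]
  exact Finset.measurable_sum _ fun i _ => measurable_const.indicator (hp i)

open Classical in
/-- The generating function of the number of independent events which occur. -/
theorem integral_rpow_card_le (ν : ι → Measure X) [∀ i, IsProbabilityMeasure (ν i)]
    (E : ι → Set X) (hE : ∀ i, MeasurableSet (E i)) {z : ℝ} (hz : 0 < z) :
    Integrable (fun ω : ι → X => z ^ ((tally fun i => ω i ∈ E i) : ℝ))
      (Measure.pi ν) ∧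
    ∫ ω, z ^ ((tally fun i => ω i ∈ E i) : ℝ) ∂(Measure.pi ν) ≤
      Real.exp ((z - 1) * ∑ i, (ν i).real (E i)) := by
  have h1 : ∀ ω : ι → X, z ^ ((tally fun i => ω i ∈ E i) : ℝ) =
      ∏ i, (1 + (E i).indicator (fun _ => z - 1) (ω i)) := by
    intro ω
    rw [tally, Real.rpow_natCast, ← Finset.prod_const, Finset.prod_filter]
    refine Finset.prod_congr rfl fun i _ => ?_
    by_cases h : ω i ∈ E i <;> simp [h]
  have hint : ∀ i, Integrable (fun y : X => 1 + (E i).indicator (fun _ => z - 1) y) (ν i) :=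
    fun i => (integrable_const _).add ((integrable_const _).indicator (hE i))
  simp_rw [h1]
  refine ⟨Integrable.fintype_prod_dep hint, ?_⟩
  rw [integral_fintype_prod_eq_prod (fun i y => 1 + (E i).indicator (fun _ => z - 1) y),
    Finset.mul_sum, Real.exp_sum]
  refine Finset.prod_le_prod (fun i _ => integral_nonneg fun y => ?_) fun i _ => ?_
  · by_cases h : y ∈ E i <;> simp [h, hz.le]
  · rw [integral_add (integrable_const _) ((integrable_const _).indicator (hE i)),
      integral_indicator_const _ (hE i)]
    simp only [integral_const, probReal_univ, smul_eq_mul, one_mul]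
    rw [mul_comm (z - 1)]
    linarith [Real.add_one_le_exp ((ν i).real (E i) * (z - 1))]

-- Markov's inequality for `z ^ N`, with `N` the count. The free base `z` matters: `z = e` serves
-- for thresholds well above the mean, and a large power of `x` for a bounded number of rare hits.
open Classical in
theorem measureReal_le_card_le (ν : ι → Measure X) [∀ i, IsProbabilityMeasure (ν i)]
    (E : ι → Set X) (hE : ∀ i, MeasurableSet (E i)) {z : ℝ} (hz : 1 ≤ z) (k : ℝ) {m : ℝ}
    (hm : ∑ i, (ν i).real (E i) ≤ m) :
    (Measure.pi ν).real {ω | k ≤ (tally fun i => ω i ∈ E i)} ≤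
      Real.exp (z * m) / z ^ k := by
  have hz0 : 0 < z := by linarith
  obtain ⟨h1, h2⟩ := integral_rpow_card_le ν E hE hz0
  have h3 := mul_meas_ge_le_integral_of_nonneg (Filter.Eventually.of_forall fun ω => by
    positivity) h1 (z ^ k)
  rw [le_div_iff₀' (by positivity)]
  have hm0 : 0 ≤ ∑ i, (ν i).real (E i) := Finset.sum_nonneg fun i _ => measureReal_nonneg
  calc z ^ k * (Measure.pi ν).real {ω | k ≤ (tally fun i => ω i ∈ E i)}
      ≤ z ^ k * (Measure.pi ν).real {ω | z ^ k ≤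
          z ^ ((tally fun i => ω i ∈ E i) : ℝ)} := by
        refine mul_le_mul_of_nonneg_left (measureReal_mono fun ω hω => ?_) (by positivity)
        exact Real.rpow_le_rpow_of_exponent_le hz hω
    _ ≤ Real.exp ((z - 1) * ∑ i, (ν i).real (E i)) := h3.trans h2
    _ ≤ Real.exp (z * m) := Real.exp_le_exp.2 (by nlinarith)

-- The lower tail: Markov's inequality for `exp (-N)`, where `exp (-1) - 1 ≤ -1/2` yields the term
-- `m / 2`.
open Classical in
theorem measureReal_card_le_le (ν : ι → Measure X) [∀ i, IsProbabilityMeasure (ν i)]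
    (E : ι → Set X) (hE : ∀ i, MeasurableSet (E i)) (k : ℝ) {m : ℝ}
    (hm : m ≤ ∑ i, (ν i).real (E i)) (hm0 : 0 ≤ m) :
    (Measure.pi ν).real {ω | ((tally fun i => ω i ∈ E i) : ℝ) ≤ k} ≤
      Real.exp (k - m / 2) := by
  set z := Real.exp (-1) with hz
  have hz0 : 0 < z := Real.exp_pos _
  have hz1 : z ≤ 1 / 2 := by
    rw [hz, Real.exp_neg, one_div]
    gcongr
    linarith [Real.add_one_le_exp (1 : ℝ)]
  obtain ⟨h1, h2⟩ := integral_rpow_card_le ν E hE hz0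
  have h3 := mul_meas_ge_le_integral_of_nonneg (Filter.Eventually.of_forall fun ω => by
    positivity) h1 (z ^ k)
  have hzk : z ^ k = Real.exp (-k) := by rw [hz, ← Real.exp_mul]; ring_nf
  have h4 : z ^ k * (Measure.pi ν).real
      {ω | ((tally fun i => ω i ∈ E i) : ℝ) ≤ k} ≤ Real.exp (-(m / 2)) := by
    calc _ ≤ z ^ k * (Measure.pi ν).real {ω | z ^ k ≤
          z ^ ((tally fun i => ω i ∈ E i) : ℝ)} := by
          refine mul_le_mul_of_nonneg_left (measureReal_mono fun ω hω => ?_) (by positivity)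
          exact Real.rpow_le_rpow_of_exponent_ge hz0 (by linarith) hω
      _ ≤ Real.exp ((z - 1) * ∑ i, (ν i).real (E i)) := h3.trans h2
      _ ≤ Real.exp (-(m / 2)) := Real.exp_le_exp.2 (by nlinarith)
  rw [hzk, Real.exp_neg k, ← div_eq_inv_mul, div_le_iff₀ (Real.exp_pos _), ← Real.exp_add] at h4
  rwa [show k - m / 2 = -(m / 2) + k by ring]

open Classical in
/-- Replacing the coordinates outside of `F` by those of an independent copy. -/
theorem measurePreserving_piecewise (ν : ι → Measure X) [∀ i, IsProbabilityMeasure (ν i)]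
    (F : Finset ι) :
    MeasurePreserving (fun p : (ι → X) × (ι → X) => fun i => if i ∈ F then p.1 i else p.2 i)
      ((Measure.pi ν).prod (Measure.pi ν)) (Measure.pi ν) := by
  have hmeas : Measurable (fun p : (ι → X) × (ι → X) => fun i => if i ∈ F then p.1 i else p.2 i) := by
    refine measurable_pi_lambda _ fun i => ?_
    by_cases h : i ∈ F <;> simp only [h, if_true, if_false] <;> fun_prop
  refine ⟨hmeas, (Measure.pi_eq fun B hB => ?_).symm⟩
  rw [Measure.map_apply hmeas (MeasurableSet.univ_pi hB)]
  have : (fun p : (ι → X) × (ι → X) => fun i => if i ∈ F then p.1 i else p.2 i) ⁻¹'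
      Set.univ.pi B = (Set.univ.pi fun i => if i ∈ F then B i else Set.univ) ×ˢ
        (Set.univ.pi fun i => if i ∈ F then Set.univ else B i) := by
    ext p
    simp only [Set.mem_preimage, Set.mem_univ_pi, Set.mem_prod]
    constructor
    · intro h
      constructor <;> intro i <;> have := h i <;> split_ifs at this ⊢ <;> simp_all
    · rintro ⟨h1, h2⟩ i
      have h1 := h1 i
      have h2 := h2 i
      split_ifs at h1 h2 ⊢ <;> assumption
  rw [this, Measure.prod_prod, Measure.pi_pi, Measure.pi_pi, ← Finset.prod_mul_distrib]
  refine Finset.prod_congr rfl fun i _ => ?_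
  split_ifs <;> simp

open Classical in
/-- To bound the probability of an event it suffices to bound the probability given the
coordinates in `F`. -/
theorem measureReal_le_of_piecewise (ν : ι → Measure X) [∀ i, IsProbabilityMeasure (ν i)]
    (F : Finset ι) (S : Set (ι → X)) (hS : MeasurableSet S) {C : ℝ} (hC : 0 ≤ C)
    (h : ∀ ω : ι → X, (Measure.pi ν).real {ω' : ι → X | (fun i => if i ∈ F then ω i else ω' i) ∈ S} ≤ C) :
    (Measure.pi ν).real S ≤ C := by
  have hp := measurePreserving_piecewise ν F
  rw [← hp.measureReal_preimage hS.nullMeasurableSet, measureReal_def]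
  refine ENNReal.toReal_le_of_le_ofReal hC ?_
  rw [Measure.prod_apply (hp.measurable hS)]
  calc _ ≤ ∫⁻ _, ENNReal.ofReal C ∂(Measure.pi ν) := by
        refine lintegral_mono fun ω => ?_
        rw [← ENNReal.ofReal_toReal (measure_ne_top (Measure.pi ν) _)]
        exact ENNReal.ofReal_le_ofReal (h ω)
    _ = _ := by simp

open Classical in
/-- A conditional version of `measureReal_le_card_le`, in which the events `Q ω` depend on the
coordinates of `ω` in `F`. -/
theorem measureReal_le_card_le_of_cond (ν : Measure X) [IsProbabilityMeasure ν]
    (F : Finset ι) (Q : (ι → X) → Set X) (hQF : ∀ ω ω', (∀ i ∈ F, ω i = ω' i) → Q ω = Q ω')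
    (hQ : ∀ ω, MeasurableSet (Q ω)) (hQ' : ∀ j, MeasurableSet {ω | ω j ∈ Q ω}) {z : ℝ} (hz : 1 ≤ z)
    (k : ℝ) {p m : ℝ} (hp : ∀ ω, ν.real (Q ω) ≤ p) (hm : Fintype.card ι * p ≤ m) :
    (Measure.pi fun _ : ι => ν).real
      {ω | k ≤ (tally fun j => j ∉ F ∧ ω j ∈ Q ω)} ≤ Real.exp (z * m) / z ^ k := by
  have hz0 : 0 < z := by linarith
  refine measureReal_le_of_piecewise _ F _ ?_ (by positivity) fun ω => ?_
  · refine measurableSet_le measurable_const (measurable_tally _ fun j => ?_)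
    by_cases hj : j ∈ F
    · simp [hj]
    · simpa [hj] using hQ' j
  · have hp0 : 0 ≤ p := le_trans measureReal_nonneg (hp ω)
    refine le_trans (measureReal_mono fun ω' hω' => ?_)
      (measureReal_le_card_le (fun _ : ι => ν) (fun j => if j ∈ F then ∅ else Q ω)
      (fun j => ?_) hz k (m := m) ?_)
    · simp only [Set.mem_ofPred_eq] at hω' ⊢
      refine hω'.trans (Nat.cast_le.2 (tally_mono fun j => ?_))
      rintro ⟨hj, h⟩
      rw [hQF _ ω (fun i hi => by simp [hi])] at h
      simpa [hj] using h
    · split_ifs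
      · exact MeasurableSet.empty
      · exact hQ ω
    · refine le_trans (Finset.sum_le_card_nsmul _ _ p fun j _ => ?_) (by simpa using hm)
      split_ifs
      · simpa using hp0
      · exact hp ω

end Counting

/-! ### The Bernoulli-Gaussian ensemble -/

/-- The law of an entry of a Bernoulli-Gaussian matrix. -/
noncomputable def entryLaw (θ : unitInterval) : Measure ℝ :=
  ((bernoulliMeasure (1 : ℝ) 0 θ).prod (gaussianReal 0 1)).map fun p => p.1 * p.2

instance (θ : unitInterval) : IsProbabilityMeasure (entryLaw θ) :=
  Measure.isProbabilityMeasure_map (by fun_prop)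

/-- The law of a row of a Bernoulli-Gaussian matrix. -/
noncomputable def rowLaw (s : ℕ) (θ : unitInterval) : Measure (Fin s → ℝ) :=
  Measure.pi fun _ => entryLaw θ

instance (s : ℕ) (θ : unitInterval) : IsProbabilityMeasure (rowLaw s θ) := by
  unfold rowLaw; infer_instance

/-- The rows are independent and identically distributed, which permits conditioning on a set of
rows. -/
theorem bernoulliGaussian_eq_pi (r s : ℕ) (θ : unitInterval) :
    bernoulliGaussian r s θ = (Measure.pi fun _ : Fin r => rowLaw s θ : Measure (Fin r → Fin s → ℝ)) := by
  have h1 : (Measure.pi fun _ : Fin r × Fin s => entryLaw θ) =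
      (Measure.pi fun _ : Fin r × Fin s =>
        (bernoulliMeasure (1 : ℝ) 0 θ).prod (gaussianReal 0 1)).map
        fun ω p => (ω p).1 * (ω p).2 := by
    rw [Measure.pi_map_pi (f := fun (_ : Fin r × Fin s) (p : ℝ × ℝ) => p.1 * p.2)
      (fun _ => by fun_prop)]
    rfl
  have h2 := Measure.infinitePi_map_curry (ι := Fin r) (κ := Fin s) (X := ℝ) fun _ _ => entryLaw θ
  simp only [Measure.infinitePi_eq_pi] at h2
  unfold rowLaw
  rw [← h2, h1, Measure.map_map (by fun_prop) (by fun_prop)]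
  rfl

theorem measurableSet_ne_zero : MeasurableSet {a : ℝ | a ≠ 0} :=
  (measurableSet_eq_fun measurable_id measurable_const).compl

theorem entryLaw_ne_zero_le (θ : unitInterval) : (entryLaw θ).real {a | a ≠ 0} ≤ θ := by
  rw [entryLaw, map_measureReal_apply (by fun_prop) measurableSet_ne_zero]
  calc _ ≤ ((bernoulliMeasure (1 : ℝ) 0 θ).prod (gaussianReal 0 1)).real
        ({a | a ≠ 0} ×ˢ Set.univ) := by
        refine measureReal_mono fun p hp => ?_
        simp only [Set.mem_preimage, Set.mem_ofPred_eq] at hp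
        exact ⟨left_ne_zero_of_mul hp, trivial⟩
    _ = θ := by
        rw [measureReal_prod_prod, probReal_univ, mul_one,
          bernoulliMeasure_real_apply_of_mem_of_notMem θ measurableSet_ne_zero] <;> simp

/-- The probability that a standard Gaussian variable is at least `2` in absolute value. -/
noncomputable def gaussianTail : ℝ := (gaussianReal 0 1).real {y | 2 ≤ |y|}

theorem gaussianTail_pos : 0 < gaussianTail := by
  rw [gaussianTail, measureReal_def]
  refine ENNReal.toReal_pos (fun h => ?_) (measure_ne_top _ _)
  have h1 := gaussianReal_absolutelyContinuous' 0 one_ne_zero h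
  have h2 : (volume : Measure ℝ) (Set.Ici 2) ≤ volume {y : ℝ | 2 ≤ |y|} :=
    measure_mono fun y hy => le_trans hy (le_abs_self y)
  rw [h1] at h2
  simp at h2

theorem le_entryLaw_two_le (θ : unitInterval) :
    θ * gaussianTail ≤ (entryLaw θ).real {a | 2 ≤ |a|} := by
  rw [entryLaw, map_measureReal_apply (by fun_prop)
    (measurableSet_le measurable_const (by fun_prop))]
  calc (θ : ℝ) * gaussianTail = ((bernoulliMeasure (1 : ℝ) 0 θ).prod (gaussianReal 0 1)).real
        ({1} ×ˢ {y | 2 ≤ |y|}) := by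
        rw [measureReal_prod_prod, gaussianTail, bernoulliMeasure_real_apply_of_mem_of_notMem] <;>
          simp
    _ ≤ _ := by
        refine measureReal_mono fun p hp => ?_
        obtain ⟨h1, h2⟩ := hp
        simp only [Set.mem_singleton_iff] at h1
        simpa [h1] using h2

/-- Chernoff's bound with parameters `±1`. An exponential tail suffices because `x` is a power of
`s`. -/
theorem gaussianReal_lt_abs_le (x : ℝ) :
    (gaussianReal 0 1).real {y | x < |y|} ≤ 4 * Real.exp (-x) := by
  have hmgf : ∀ t, mgf id (gaussianReal 0 1) t = Real.exp (t ^ 2 / 2) := fun t => by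
    rw [mgf_gaussianReal (μ := 0) (v := 1) Measure.map_id]; simp
  have hint : ∀ t, Integrable (fun y : ℝ => Real.exp (t * id y)) (gaussianReal 0 1) := fun t =>
    integrable_exp_mul_gaussianReal t
  have h1 := measure_ge_le_exp_mul_mgf (μ := gaussianReal 0 1) (X := id) x zero_le_one (hint 1)
  have h2 := measure_le_le_exp_mul_mgf (μ := gaussianReal 0 1) (X := id) (-x)
    (t := -1) (by norm_num) (hint (-1))
  rw [hmgf] at h1 h2
  have h3 : Real.exp (1 / 2) ≤ 2 := by
    have : Real.exp (1 / 2) ^ 2 ≤ 2 ^ 2 := by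
      rw [← Real.exp_nat_mul]
      norm_num
      linarith [Real.exp_one_lt_d9]
    exact le_of_sq_le_sq this (by norm_num)
  have hsub : {y : ℝ | x < |y|} ⊆ {y | x ≤ id y} ∪ {y | id y ≤ -x} := by
    intro y hy
    rcases lt_abs.1 (show x < |y| from hy) with h | h
    · exact Or.inl (by simpa using h.le)
    · exact Or.inr (by simp only [id, Set.mem_ofPred_eq]; linarith)
  have h4 := (measureReal_mono (μ := gaussianReal 0 1) hsub).trans (measureReal_union_le _ _)
  norm_num at h1 h2 h4
  have h5 := Real.exp_pos (-x)
  nlinarith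

theorem entryLaw_lt_abs_le (θ : unitInterval) {x : ℝ} (hx : 0 ≤ x) :
    (entryLaw θ).real {a | x < |a|} ≤ 4 * Real.exp (-x) := by
  rw [entryLaw, map_measureReal_apply (by fun_prop)
    (measurableSet_lt measurable_const (by fun_prop))]
  have hsub : (fun p : ℝ × ℝ => p.1 * p.2) ⁻¹' {a | x < |a|} ⊆
      ({1, 0}ᶜ ×ˢ Set.univ) ∪ (Set.univ ×ˢ {y | x < |y|}) := by
    rintro ⟨b, y⟩ h
    simp only [Set.mem_preimage, Set.mem_ofPred_eq, abs_mul] at h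
    by_cases hb : b = 1 ∨ b = 0
    · rcases hb with rfl | rfl
      · right; simpa using h
      · simp at h; linarith
    · left; simpa using hb
  refine (measureReal_mono hsub).trans ((measureReal_union_le _ _).trans ?_)
  have hBer : (bernoulliMeasure (1 : ℝ) 0 θ).real {1, 0}ᶜ = 0 :=
    bernoulliMeasure_real_apply_of_notMem_of_notMem _ ((Set.toFinite _).measurableSet.compl)
      (by simp) (by simp)
  rw [measureReal_prod_prod, measureReal_prod_prod, probReal_univ, probReal_univ, one_mul, mul_one,
    hBer, zero_add]
  exact gaussianReal_lt_abs_le x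

/-! ### Bernoulli-Gaussian matrices are typical -/

theorem measureReal_exists_le {Ω ι : Type*} [MeasurableSpace Ω] [Fintype ι] (μ : Measure Ω)
    (p : ι → Ω → Prop) {C : ℝ} (h : ∀ i, μ.real {ω | p i ω} ≤ C) :
    μ.real {ω | ∃ i, p i ω} ≤ Fintype.card ι * C := by
  have e : {ω | ∃ i, p i ω} = ⋃ i, {ω | p i ω} := by ext; simp
  rw [e]
  refine (measureReal_iUnion_fintype_le _).trans
    ((Finset.sum_le_card_nsmul _ _ C fun i _ => h i).trans ?_)
  simp

theorem measurable_apply_ne_zero {r s : ℕ} (i : Fin r) (l : Fin s) :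
    Measurable fun A : Fin r → Fin s → ℝ => A i l ≠ 0 := by
  have h : Measurable fun A : Fin r → Fin s → ℝ => A i l := by fun_prop
  exact measurableSet_setOfPred.1 (measurableSet_ne_zero.preimage h)

theorem measurable_row_ne_zero {s : ℕ} (l : Fin s) : Measurable fun y : Fin s → ℝ => y l ≠ 0 := by
  have h : Measurable fun y : Fin s → ℝ => y l := by fun_prop
  exact measurableSet_setOfPred.1 (measurableSet_ne_zero.preimage h)

theorem measurable_le_card {ι Ω : Type*} [Fintype ι] [MeasurableSpace Ω] (k : ℝ) (p : ι → Ω → Prop)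
    (hp : ∀ i, Measurable (p i)) :
    Measurable fun ω => k ≤ ((tally fun i => p i ω) : ℝ) :=
  measurableSet_setOfPred.1 <| measurableSet_le measurable_const <|
    measurable_tally _ fun i => measurableSet_setOfPred.2 (hp i)

theorem measurable_card_le {ι Ω : Type*} [Fintype ι] [MeasurableSpace Ω] (k : ℝ) (p : ι → Ω → Prop)
    (hp : ∀ i, Measurable (p i)) :
    Measurable fun ω => ((tally fun i => p i ω) : ℝ) ≤ k :=
  measurableSet_setOfPred.1 <| measurableSet_le (
    measurable_tally _ fun i => measurableSet_setOfPred.2 (hp i)) measurable_const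

/-- A row seldom meets a small set of columns often. -/
theorem rowLaw_le_card_le {s : ℕ} (θ : unitInterval) (p : Fin s → Prop) {z m : ℝ}
    (hz : 1 ≤ z) (k : ℝ) (hm : (tally p) * (θ : ℝ) ≤ m) :
    (rowLaw s θ).real {y | k ≤ (tally fun l => y l ≠ 0 ∧ p l)} ≤
      Real.exp (z * m) / z ^ k := by
  classical
  refine le_trans (le_of_eq ?_) (measureReal_le_card_le (fun _ : Fin s => entryLaw θ)
    (fun l => if p l then {a | a ≠ 0} else ∅) (fun l => ?_) hz k (m := m) ?_)
  · congr 1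
    ext y
    simp only [Set.mem_ofPred_eq]
    have : (fun l => y l ≠ 0 ∧ p l) =
        fun l => y l ∈ (if p l then {a : ℝ | a ≠ 0} else ∅ : Set ℝ) := by
      ext l
      by_cases h : p l <;> simp [h]
    rw [this]
  · split_ifs
    · exact measurableSet_ne_zero
    · exact MeasurableSet.empty
  · refine le_trans ?_ hm
    rw [tally, ← nsmul_eq_mul, ← Finset.sum_const, Finset.sum_filter]
    refine Finset.sum_le_sum fun l _ => ?_
    split_ifs
    · exact entryLaw_ne_zero_le θ
    · simp

theorem rowLaw_pair_le {s : ℕ} (θ : unitInterval) {l l' : Fin s} (h : l' ≠ l) :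
    (rowLaw s θ).real {y | y l ≠ 0 ∧ y l' ≠ 0} ≤ (θ : ℝ) * θ := by
  have e : {y : Fin s → ℝ | y l ≠ 0 ∧ y l' ≠ 0} =
      Set.univ.pi fun i => if i = l ∨ i = l' then {a | a ≠ 0} else Set.univ := by
    ext y
    simp only [Set.mem_ofPred_eq, Set.mem_univ_pi]
    constructor
    · rintro ⟨h1, h2⟩ i
      split_ifs with hi
      · rcases hi with rfl | rfl <;> assumption
      · trivial
    · intro hy
      have h1 := hy l
      have h2 := hy l'
      simp only [true_or, or_true, if_true] at h1 h2
      exact ⟨h1, h2⟩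
  rw [e, measureReal_def, rowLaw, Measure.pi_pi, ENNReal.toReal_prod]
  have h2 : ∀ i, (entryLaw θ (if i = l ∨ i = l' then {a : ℝ | a ≠ 0} else Set.univ)).toReal =
      if i ∈ ({l, l'} : Finset (Fin s)) then (entryLaw θ).real {a | a ≠ 0} else 1 := by
    intro i
    by_cases hi : i = l ∨ i = l'
    · simp only [hi, if_true, Finset.mem_insert, Finset.mem_singleton]; rfl
    · simp [hi]
  simp_rw [h2]
  rw [← Finset.prod_filter, Finset.prod_const]
  have h3 : (Finset.univ.filter fun i => i ∈ ({l, l'} : Finset (Fin s))).card = 2 := by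
    rw [Finset.filter_mem_eq_inter, Finset.univ_inter, Finset.card_pair h.symm]
  rw [h3, sq]
  exact mul_le_mul (entryLaw_ne_zero_le θ) (entryLaw_ne_zero_le θ) measureReal_nonneg θ.2.1

/-! ### The failure probability of each property in `IsTypical`. -/

/-- The relations between the size `s`, the density `θ` and the scale `x`. -/
structure IsRegime (s : ℕ) (θ : unitInterval) (x : ℝ) (κ c : ℕ) : Prop where
  large : 8 * c ^ 2 + 8 ≤ x
  tail : 4 ≤ gaussianTail * x
  one_le_kappa : 1 ≤ κ
  pow_eq : x ^ c = s
  le_mean : x ^ (κ + 10) ≤ s * θ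
  mean_le : s * (θ : ℝ) ≤ x ^ (κ + 11)
  sparse : s * (θ : ℝ) ^ 2 * x ^ 20 ≤ 1

namespace IsRegime

variable {s : ℕ} {θ : unitInterval} {x : ℝ} {κ c : ℕ} (h : IsRegime s θ x κ c)
include h

theorem one_le : 1 ≤ x := by
  have := h.large
  nlinarith [sq_nonneg (c : ℝ)]

theorem eight_le : 8 ≤ x := by
  have := h.large
  nlinarith [sq_nonneg (c : ℝ)]

/-- The sparsity condition in the form used below: the expected number of nonzero entries of a row
within the support of another typical row is at most `x ^ (-18)`. -/
theorem row_sparse : x ^ (κ + 12) * (θ : ℝ) ≤ 1 / x ^ 18 := by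
  have h1 := h.one_le
  have hθ := θ.2.1
  rw [le_div_iff₀ (by positivity)]
  calc x ^ (κ + 12) * (θ : ℝ) * x ^ 18 = x ^ (κ + 10) * (θ * x ^ 20) := by ring
    _ ≤ s * (θ : ℝ) * (θ * x ^ 20) := mul_le_mul_of_nonneg_right h.le_mean (by positivity)
    _ = s * (θ : ℝ) ^ 2 * x ^ 20 := by ring
    _ ≤ 1 := h.sparse

/-- The failure bounds of this part share one form; the constant `10000` is dictated by
`prob_common`. -/
theorem prob_large_entry (i j : Fin s) :
    (Measure.pi fun _ : Fin s => rowLaw s θ).real {A | x < |A i j|} ≤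
      10000 * Real.exp (-(x / 2)) := by
  have h1 := h.one_le
  have hm : MeasurableSet {a : ℝ | x < |a|} := measurableSet_lt measurable_const (by fun_prop)
  have hm2 : MeasurableSet {y : Fin s → ℝ | x < |y j|} :=
    measurableSet_lt measurable_const (by fun_prop)
  have e1 := (measurePreserving_eval (fun _ : Fin s => rowLaw s θ) i).measureReal_preimage
    hm2.nullMeasurableSet
  have e2 := (measurePreserving_eval (fun _ : Fin s => entryLaw θ) j).measureReal_preimage
    hm.nullMeasurableSet
  have e3 := entryLaw_lt_abs_le θ (x := x) (by linarith)
  rw [← e2] at e3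
  calc _ = (rowLaw s θ).real {y : Fin s → ℝ | x < |y j|} := e1
    _ ≤ 4 * Real.exp (-x) := e3
    _ ≤ 10000 * Real.exp (-(x / 2)) := by
        have : Real.exp (-x) ≤ Real.exp (-(x / 2)) := Real.exp_le_exp.2 (by linarith)
        nlinarith [Real.exp_pos (-x)]

theorem prob_row_card (i : Fin s) :
    (Measure.pi fun _ : Fin s => rowLaw s θ).real
      {A | x ^ (κ + 12) < (tally fun l => A i l ≠ 0)} ≤
      10000 * Real.exp (-(x / 2)) := by
  have h1 := h.one_le
  have h8 := h.eight_le
  have hm : MeasurableSet {y : Fin s → ℝ |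
      x ^ (κ + 12) ≤ ((tally fun l => y l ≠ 0 ∧ True) : ℝ)} :=
    measurableSet_setOfPred.2 (measurable_le_card _ _ fun l =>
      (measurable_row_ne_zero l).and measurable_const)
  have e1 := (measurePreserving_eval (fun _ : Fin s => rowLaw s θ) i).measureReal_preimage
    hm.nullMeasurableSet
  have e2 := rowLaw_le_card_le (s := s) θ (fun _ => True) (z := Real.exp 1) (m := x ^ (κ + 11))
    (Real.one_le_exp zero_le_one) (x ^ (κ + 12)) (by simpa [tally] using h.mean_le)
  rw [← e1] at e2
  refine (measureReal_mono fun A hA => ?_).trans (e2.trans ?_)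
  · simp only [Set.mem_ofPred_eq, Set.mem_preimage, and_true, Function.eval] at hA ⊢
    exact hA.le
  calc _ = Real.exp (Real.exp 1 * x ^ (κ + 11) - x ^ (κ + 12)) := by
        rw [Real.exp_one_rpow, Real.exp_sub]
    _ ≤ Real.exp (-(x / 2)) := by
        have h3 := Real.exp_one_lt_d9
        have h4 : x ≤ x ^ (κ + 11) := le_self_pow₀ h1 (by omega)
        have h5 : x ^ (κ + 12) = x * x ^ (κ + 11) := by ring
        refine Real.exp_le_exp.2 ?_
        rw [h5]
        nlinarith
    _ ≤ _ := by nlinarith [Real.exp_pos (-(x / 2))]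

theorem prob_col_large (l : Fin s) :
    (Measure.pi fun _ : Fin s => rowLaw s θ).real
      {A | ((tally fun j => 2 ≤ |A j l|) : ℝ) < x ^ (κ + 9)} ≤
      10000 * Real.exp (-(x / 2)) := by
  have h1 := h.one_le
  have h8 := h.eight_le
  have hg := gaussianTail_pos
  have hm : MeasurableSet {a : ℝ | 2 ≤ |a|} := measurableSet_le measurable_const (by fun_prop)
  have hm2 : MeasurableSet {y : Fin s → ℝ | 2 ≤ |y l|} :=
    measurableSet_le measurable_const (by fun_prop)
  have e1 := (measurePreserving_eval (fun _ : Fin s => entryLaw θ) l).measureReal_preimage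
    hm.nullMeasurableSet
  have e1' : (rowLaw s θ).real {y : Fin s → ℝ | 2 ≤ |y l|} = (entryLaw θ).real {a | 2 ≤ |a|} := e1
  have e2 := measureReal_card_le_le (fun _ : Fin s => rowLaw s θ)
    (fun _ => {y : Fin s → ℝ | 2 ≤ |y l|}) (fun _ => hm2) (x ^ (κ + 9))
    (m := x ^ (κ + 10) * gaussianTail) (by
      simp only [e1', Finset.sum_const, Finset.card_univ, Fintype.card_fin, nsmul_eq_mul]
      calc x ^ (κ + 10) * gaussianTail ≤ s * (θ : ℝ) * gaussianTail :=
            mul_le_mul_of_nonneg_right h.le_mean hg.le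
        _ = s * (θ * gaussianTail) := by ring
        _ ≤ _ := mul_le_mul_of_nonneg_left (le_entryLaw_two_le θ) (by positivity)) (by positivity)
  refine (measureReal_mono fun A hA => ?_).trans (e2.trans ?_)
  · simp only [Set.mem_ofPred_eq] at hA ⊢
    exact hA.le
  calc _ ≤ Real.exp (-(x / 2)) := by
        have h4 : x ≤ x ^ (κ + 9) := le_self_pow₀ h1 (by omega)
        have h5 : x ^ (κ + 10) = x * x ^ (κ + 9) := by ring
        refine Real.exp_le_exp.2 ?_
        rw [h5]
        -- By `tail` the mean is at least four times the threshold, so the exponent is at most `-x ^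
        -- (κ + 9)`.
        have := mul_le_mul_of_nonneg_right h.tail (by positivity : 0 ≤ x ^ (κ + 9))
        linarith
    _ ≤ _ := by nlinarith [Real.exp_pos (-(x / 2))]

/-- Conditionally on row `i`, the overlap is a sum of independent indicators of mean at most `1`.
The size of row `i` is part of the event, which is therefore empty given a row `i` that is too full.
-/
theorem prob_row_overlap (i i' : Fin s) (hii : i ≠ i') :
    (Measure.pi fun _ : Fin s => rowLaw s θ).real
      {A | ((tally fun l => A i l ≠ 0) : ℝ) ≤ x ^ (κ + 12) ∧
        x < (tally fun l => A i l ≠ 0 ∧ A i' l ≠ 0)} ≤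
      10000 * Real.exp (-(x / 2)) := by
  have h1 := h.one_le
  have h8 := h.eight_le
  calc _ ≤ (Measure.pi fun _ : Fin s => rowLaw s θ).real
            {A | ((tally fun l => A i l ≠ 0) : ℝ) ≤ x ^ (κ + 12) ∧
              x ≤ (tally fun l => A i' l ≠ 0 ∧ A i l ≠ 0)} := by
        refine measureReal_mono fun A hA => ?_
        simp only [Set.mem_ofPred_eq] at hA ⊢
        simp only [and_comm (a := A i' _ ≠ 0)]
        exact ⟨hA.1, hA.2.le⟩
    _ ≤ Real.exp (Real.exp 1 * 1) / Real.exp 1 ^ x := by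
        refine measureReal_le_of_piecewise _ {i} _ ?_ (by positivity) fun ω => ?_
        · exact measurableSet_setOfPred.2 (.and
            (measurable_card_le _ _ fun l => measurable_apply_ne_zero i l)
            (measurable_le_card _ _ fun l =>
              (measurable_apply_ne_zero i' l).and (measurable_apply_ne_zero i l)))
        · simp only [Set.mem_ofPred_eq, Finset.mem_singleton, if_true, hii.symm, if_false]
          by_cases hω : ((tally fun l => ω i l ≠ 0) : ℝ) ≤ x ^ (κ + 12)
          · simp only [hω, true_and]
            have hm : MeasurableSet {y : Fin s → ℝ |
                x ≤ ((tally fun l => y l ≠ 0 ∧ ω i l ≠ 0) : ℝ)} :=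
              measurableSet_setOfPred.2 (measurable_le_card _ _ fun l =>
                (measurable_row_ne_zero l).and measurable_const)
            have e1 := (measurePreserving_eval (fun _ : Fin s => rowLaw s θ) i').measureReal_preimage
              hm.nullMeasurableSet
            have e2 := rowLaw_le_card_le (s := s) θ (fun l => ω i l ≠ 0) (z := Real.exp 1) (m := 1)
              (Real.one_le_exp zero_le_one) x (by
                refine (mul_le_mul_of_nonneg_right hω θ.2.1).trans (h.row_sparse.trans ?_)
                rw [div_le_one (by positivity)]
                exact one_le_pow₀ h1)
            rw [← e1] at e2
            exact e2
          · simp only [hω, false_and, Set.ofPred_false, measureReal_empty]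
            positivity
    _ = Real.exp (Real.exp 1 - x) := by rw [Real.exp_one_rpow, mul_one, Real.exp_sub]
    _ ≤ Real.exp (-(x / 2)) := by
        refine Real.exp_le_exp.2 ?_
        have h3 := Real.exp_one_lt_d9
        linarith
    _ ≤ _ := by nlinarith [Real.exp_pos (-(x / 2))]

/-- Given row `i`, another row is a detour with probability at most `x ^ (κ + 12) θ²`, independently
of the rest. The mean number of detours is thus at most `s θ · x ^ (κ + 12) θ ≤ x ^ (κ - 7)`, well
below `x ^ κ`. -/
theorem prob_detour (i l : Fin s) :
    (Measure.pi fun _ : Fin s => rowLaw s θ).real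
      {A | ((tally fun l => A i l ≠ 0) : ℝ) ≤ x ^ (κ + 12) ∧ x ^ κ <
        (tally fun j => j ≠ i ∧ A j l ≠ 0 ∧ ∃ l', l' ≠ l ∧ A i l' ≠ 0 ∧ A j l' ≠ 0)} ≤
      10000 * Real.exp (-(x / 2)) := by
  classical
  have h1 := h.one_le
  have h8 := h.eight_le
  have hθ := θ.2.1
  have hx0 : 0 < x := by linarith
  have hm := measureReal_le_card_le_of_cond (ι := Fin s) (rowLaw s θ) {i}
    (fun ω => {y | ((tally fun l => ω i l ≠ 0) : ℝ) ≤ x ^ (κ + 12) ∧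
      ∃ l', l' ≠ l ∧ ω i l' ≠ 0 ∧ (y l ≠ 0 ∧ y l' ≠ 0)})
    (fun ω ω' hω => by simp only [hω i (Finset.mem_singleton_self i)])
    (fun ω => measurableSet_setOfPred.2 (measurable_const.and (.exists fun l' =>
      measurable_const.and (measurable_const.and
        ((measurable_row_ne_zero l).and (measurable_row_ne_zero l'))))))
    (fun j => measurableSet_setOfPred.2 (.and
      (measurable_card_le _ _ fun l => measurable_apply_ne_zero i l) (.exists fun l' =>
        measurable_const.and ((measurable_apply_ne_zero i l').and
          ((measurable_apply_ne_zero j l).and (measurable_apply_ne_zero j l'))))))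
    (Real.one_le_exp zero_le_one) (x ^ κ) (p := x ^ (κ + 12) * (θ * θ)) (m := x ^ κ / 8)
    (fun ω => ?_) ?_
  · refine (measureReal_mono fun A hA => ?_).trans (hm.trans ?_)
    · simp only [Set.mem_ofPred_eq, Finset.mem_singleton] at hA ⊢
      refine hA.2.le.trans (Nat.cast_le.2 (tally_mono fun j hj => ?_))
      obtain ⟨hji, hjl, l', hl', h2, h3⟩ := hj
      exact ⟨hji, hA.1, l', hl', h2, hjl, h3⟩
    · rw [Real.exp_one_rpow, ← Real.exp_sub]
      have h3 := Real.exp_one_lt_d9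
      have h4 : x ≤ x ^ κ := le_self_pow₀ h1 (by have := h.one_le_kappa; omega)
      have h5 : Real.exp (Real.exp 1 * (x ^ κ / 8) - x ^ κ) ≤ Real.exp (-(x / 2)) :=
        Real.exp_le_exp.2 (by nlinarith)
      nlinarith [Real.exp_pos (-(x / 2))]
  · by_cases hω : ((tally fun l => ω i l ≠ 0) : ℝ) ≤ x ^ (κ + 12)
    · simp only [hω, true_and]
      have hsub : {y : Fin s → ℝ | ∃ l', l' ≠ l ∧ ω i l' ≠ 0 ∧ (y l ≠ 0 ∧ y l' ≠ 0)} ⊆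
          ⋃ l' ∈ (Finset.univ.filter fun l' => ω i l' ≠ 0).erase l, {y | y l ≠ 0 ∧ y l' ≠ 0} := by
        intro y hy
        obtain ⟨l', h2, h3, h4⟩ := hy
        simp only [Set.mem_iUnion]
        exact ⟨l', by simp [h2, h3], h4⟩
      refine (measureReal_mono hsub (measure_ne_top _ _)).trans ((measureReal_biUnion_finset_le _ _).trans ?_)
      refine (Finset.sum_le_card_nsmul _ _ ((θ : ℝ) * θ) fun l' hl' =>
        rowLaw_pair_le θ (Finset.ne_of_mem_erase hl')).trans ?_
      rw [nsmul_eq_mul]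
      refine mul_le_mul_of_nonneg_right (le_trans ?_ hω) (by positivity)
      rw [tally_eq]
      exact Nat.cast_le.2 (Finset.card_le_card (Finset.erase_subset _ _))
    · simp only [hω, false_and, Set.ofPred_false, measureReal_empty]
      positivity
  · rw [Fintype.card_fin]
    calc (s : ℝ) * (x ^ (κ + 12) * (θ * θ)) = s * θ * (x ^ (κ + 12) * θ) := by ring
      _ ≤ x ^ (κ + 11) * (1 / x ^ 18) :=
          mul_le_mul h.mean_le h.row_sparse (by positivity) (by positivity)
      _ = x ^ κ * (1 / x ^ 7) := by field_simp; ring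
      _ ≤ x ^ κ * (1 / 8) := by
          have : x ≤ x ^ 7 := le_self_pow₀ h1 (by norm_num)
          gcongr
          linarith
      _ = x ^ κ / 8 := by ring

/-- Two Chernoff bounds. Given `F`, a further row meets the union of the supports `x ^ (-17)` times
on average, hence `c` times with probability at most `e x ^ (-17 c) = e s ^ (-17)`. The number of
such rows then has mean at most `e`, and exceeds `x ^ κ` with exponentially small probability, which
survives the union over all `F`. -/
theorem prob_common (F : Finset (Fin s)) (hF : F.card = 2 * c) :
    (Measure.pi fun _ : Fin s => rowLaw s θ).real
      {A | (∀ i ∈ F, ((tally fun l => A i l ≠ 0) : ℝ) ≤ x ^ (κ + 12)) ∧ x ^ κ <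
        (tally fun j => j ∉ F ∧ (c : ℝ) ≤ (tally fun l => A j l ≠ 0 ∧ ∃ i ∈ F, A i l ≠ 0))} ≤
      10000 * Real.exp (-(x / 2)) := by
  classical
  have h1 := h.one_le
  have h8 := h.eight_le
  have hθ := θ.2.1
  have hx0 : 0 < x := by linarith
  have hcx : 2 * (c : ℝ) ≤ x := by
    have := h.large
    nlinarith [sq_nonneg ((c : ℝ) - 1)]
  have hm := measureReal_le_card_le_of_cond (ι := Fin s) (rowLaw s θ) F
    (fun ω => {y | (∀ i, i ∈ F → ((tally fun l => ω i l ≠ 0) : ℝ) ≤ x ^ (κ + 12)) ∧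
      (c : ℝ) ≤ (tally fun l => y l ≠ 0 ∧ ∃ i, i ∈ F ∧ ω i l ≠ 0)})
    (fun ω ω' hω => by
      have e1 : ∀ l, (∃ i, i ∈ F ∧ ω i l ≠ 0) ↔ ∃ i, i ∈ F ∧ ω' i l ≠ 0 := fun l =>
        exists_congr fun i => and_congr_right fun hi => by rw [hω i hi]
      have e2 : (∀ i, i ∈ F → ((tally fun l => ω i l ≠ 0) : ℝ) ≤ x ^ (κ + 12)) ↔
          ∀ i, i ∈ F → ((tally fun l => ω' i l ≠ 0) : ℝ) ≤ x ^ (κ + 12) :=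
        forall_congr' fun i => imp_congr_right fun hi => by rw [hω i hi]
      simp only [e1, e2])
    (fun ω => measurableSet_setOfPred.2 (measurable_const.and (measurable_le_card _ _ fun l =>
      (measurable_row_ne_zero l).and measurable_const)))
    (fun j => measurableSet_setOfPred.2 (.and
      (.forall fun i => measurable_const.imp
        (measurable_card_le _ _ fun l => measurable_apply_ne_zero i l))
      (measurable_le_card _ _ fun l => (measurable_apply_ne_zero j l).and
        (.exists fun i => measurable_const.and (measurable_apply_ne_zero i l)))))
    (Real.one_le_exp zero_le_one) (x ^ κ) (p := Real.exp 1 / x ^ (17 * c)) (m := Real.exp 1)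
    (fun ω => ?_) ?_
  · refine (measureReal_mono fun A hA => ?_).trans (hm.trans ?_)
    · simp only [Set.mem_ofPred_eq] at hA ⊢
      exact hA.2.le.trans (Nat.cast_le.2 (tally_mono fun j hj => ⟨hj.1, hA.1, hj.2⟩))
    · rw [Real.exp_one_rpow, ← Real.exp_sub]
      have h3 := Real.exp_one_lt_d9
      have h4 : x ≤ x ^ κ := le_self_pow₀ h1 (by have := h.one_le_kappa; omega)
      have h5 : Real.exp (Real.exp 1 * Real.exp 1 - x ^ κ) ≤ Real.exp (9 + -(x / 2)) :=
        Real.exp_le_exp.2 (by nlinarith [Real.exp_pos 1])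
      -- The number `9` bounds `e · e`, the base of the Chernoff bound times the mean.
      have h6 : Real.exp 9 ≤ 10000 := by
        have : Real.exp 9 = Real.exp 1 ^ 9 := by rw [← Real.exp_nat_mul]; norm_num
        rw [this]
        calc Real.exp 1 ^ 9 ≤ (2.7182818286 : ℝ) ^ 9 := by gcongr
          _ ≤ 10000 := by norm_num
      rw [Real.exp_add] at h5
      exact h5.trans (mul_le_mul_of_nonneg_right h6 (Real.exp_pos _).le)
  · by_cases hω : ∀ i, i ∈ F → ((tally fun l => ω i l ≠ 0) : ℝ) ≤ x ^ (κ + 12)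
    · have hT : ((tally fun l => ∃ i, i ∈ F ∧ ω i l ≠ 0) : ℝ) ≤ 2 * c * x ^ (κ + 12) := by
        have hsub : (Finset.univ.filter fun l => ∃ i, i ∈ F ∧ ω i l ≠ 0) ⊆
            F.biUnion fun i => Finset.univ.filter fun l => ω i l ≠ 0 := by
          intro l hl
          obtain ⟨i, hi, hil⟩ := (Finset.mem_filter.1 hl).2
          exact Finset.mem_biUnion.2 ⟨i, hi, Finset.mem_filter.2 ⟨Finset.mem_univ _, hil⟩⟩
        rw [tally_eq]
        refine le_trans (Nat.cast_le.2 ((Finset.card_le_card hsub).trans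
          Finset.card_biUnion_le)) ?_
        push_cast
        refine (Finset.sum_le_card_nsmul _ _ (x ^ (κ + 12)) fun i hi => ?_).trans ?_
        · rw [← tally_eq]
          exact hω i hi
        · rw [nsmul_eq_mul, hF]
          push_cast
          rfl
      have h2 := rowLaw_le_card_le (s := s) θ (fun l => ∃ i, i ∈ F ∧ ω i l ≠ 0) (z := x ^ 17)
        (m := x * (1 / x ^ 18)) (one_le_pow₀ h1) (c : ℝ) (by
          calc _ ≤ 2 * c * x ^ (κ + 12) * (θ : ℝ) := mul_le_mul_of_nonneg_right hT hθ
            _ = 2 * c * (x ^ (κ + 12) * (θ : ℝ)) := by ring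
            _ ≤ x * (1 / x ^ 18) := mul_le_mul hcx h.row_sparse (by positivity) (by positivity))
      have e1 : x ^ 17 * (x * (1 / x ^ 18)) = 1 := by field_simp
      rw [e1, Real.rpow_natCast, ← pow_mul] at h2
      refine (measureReal_mono fun y hy => ?_).trans h2
      exact hy.2
    · simp only [hω, false_and, Set.ofPred_false, measureReal_empty]
      positivity
  · rw [Fintype.card_fin, ← h.pow_eq]
    have e1 : x ^ c * (Real.exp 1 / x ^ (17 * c)) = Real.exp 1 * (1 / x ^ (16 * c)) := by
      rw [show 17 * c = c + 16 * c by ring, pow_add]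
      field_simp
    rw [e1]
    refine mul_le_of_le_one_right (Real.exp_pos _).le ?_
    rw [div_le_one (by positivity)]
    exact one_le_pow₀ h1

/-- Union bound over six kinds of failure, each with at most `s ^ (2 c + 2)` instances; the sets `F`
number at most `s ^ (2 c)`. The bound on the rows inside the conditional events is supplied by the
complement of the second kind. -/
theorem prob_not_typical :
    bernoulliGaussian s s θ {A | ¬ IsTypical x κ c A} ≤
      ENNReal.ofReal (60000 * s ^ (2 * c + 2) * Real.exp (-(x / 2))) := by
  classical
  have h1 := h.one_le
  set μ : Measure (Fin s → Fin s → ℝ) := Measure.pi fun _ : Fin s => rowLaw s θ with hμ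
  set B : ℝ := 10000 * Real.exp (-(x / 2)) with hB
  have hB0 : 0 ≤ B := by positivity
  have b1 := measureReal_exists_le μ (fun (p : Fin s × Fin s) A => x < |A p.1 p.2|) (C := B)
    fun p => h.prob_large_entry p.1 p.2
  have b2 := measureReal_exists_le μ
    (fun (i : Fin s) A => x ^ (κ + 12) < (tally fun l => A i l ≠ 0)) (C := B) h.prob_row_card
  have b3 := measureReal_exists_le μ
    (fun (l : Fin s) A => ((tally fun j => 2 ≤ |A j l|) : ℝ) < x ^ (κ + 9)) (C := B) h.prob_col_large
  have b4 := measureReal_exists_le μ (fun (p : Fin s × Fin s) A => p.1 ≠ p.2 ∧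
    ((tally fun l => A p.1 l ≠ 0) : ℝ) ≤ x ^ (κ + 12) ∧
        x < (tally fun l => A p.1 l ≠ 0 ∧ A p.2 l ≠ 0)) (C := B) (fun p => by
      by_cases hp : p.1 = p.2
      · simpa [hp] using hB0
      · simpa [hp] using h.prob_row_overlap p.1 p.2 hp)
  have b5 := measureReal_exists_le μ (fun (p : Fin s × Fin s) A =>
    ((tally fun l => A p.1 l ≠ 0) : ℝ) ≤ x ^ (κ + 12) ∧ x ^ κ <
        (tally fun j => j ≠ p.1 ∧ A j p.2 ≠ 0 ∧ ∃ l', l' ≠ p.2 ∧ A p.1 l' ≠ 0 ∧ A j l' ≠ 0))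
    (C := B) fun p => h.prob_detour p.1 p.2
  have b6 := measureReal_exists_le μ
    (fun (F : {F // F ∈ Finset.powersetCard (2 * c) (Finset.univ : Finset (Fin s))}) A =>
      (∀ i ∈ F.1, ((tally fun l => A i l ≠ 0) : ℝ) ≤ x ^ (κ + 12)) ∧ x ^ κ <
        (tally fun j => j ∉ F.1 ∧ (c : ℝ) ≤ (tally fun l => A j l ≠ 0 ∧ ∃ i ∈ F.1, A i l ≠ 0)))
    (C := B) fun F => h.prob_common F.1 (Finset.mem_powersetCard.1 F.2).2
  rw [bernoulliGaussian_eq_pi, ← hμ]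
  change μ {A : Fin s → Fin s → ℝ | ¬ IsTypical x κ c (Matrix.of A)} ≤ _
  rw [← ENNReal.ofReal_toReal (measure_ne_top μ _)]
  refine ENNReal.ofReal_le_ofReal ?_
  rw [← measureReal_def]
  have hs1 : (1 : ℝ) ≤ s := by rw [← h.pow_eq]; exact one_le_pow₀ h1
  have hsq : (s : ℝ) * s ≤ s ^ (2 * c + 2) := by
    rw [← sq]; exact pow_le_pow_right₀ hs1 (by omega)
  have hs' : (s : ℝ) ≤ s ^ (2 * c + 2) := le_self_pow₀ hs1 (by omega)
  have hcard : ((Fintype.card {F // F ∈ Finset.powersetCard (2 * c) (Finset.univ : Finset (Fin s))} :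
      ℕ) : ℝ) ≤ s ^ (2 * c + 2) := by
    rw [Fintype.card_coe, Finset.card_powersetCard, Finset.card_univ, Fintype.card_fin]
    refine le_trans (by exact_mod_cast Nat.choose_le_pow s (2 * c)) (?_ : (s : ℝ) ^ (2 * c) ≤ _)
    exact pow_le_pow_right₀ hs1 (by omega)
  rw [Fintype.card_prod, Fintype.card_fin] at b1 b4 b5
  rw [Fintype.card_fin] at b2 b3
  push_cast at b1 b4 b5
  have m1 := mul_le_mul_of_nonneg_right hsq hB0
  have m2 := mul_le_mul_of_nonneg_right hs' hB0
  have m3 := mul_le_mul_of_nonneg_right hcard hB0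
  have e : 60000 * (s : ℝ) ^ (2 * c + 2) * Real.exp (-(x / 2)) = 6 * (s ^ (2 * c + 2) * B) := by
    rw [hB]; ring
  rw [e]
  refine le_trans ((measureReal_mono (fun A hA => ?_)).trans
    ((measureReal_union_le _ _).trans (add_le_add b1
      ((measureReal_union_le _ _).trans (add_le_add b2
      ((measureReal_union_le _ _).trans (add_le_add b3
      ((measureReal_union_le _ _).trans (add_le_add b4
      ((measureReal_union_le _ _).trans (add_le_add b5 b6))))))))))) ?_
  · by_contra hne
    simp only [Set.mem_union, Set.mem_ofPred_eq, not_or, not_exists, not_lt, not_and] at hne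
    obtain ⟨n1, n2, n3, n4, n5, n6⟩ := hne
    refine hA ⟨fun i j => n1 (i, j), fun i => ?_, fun l => ?_, fun i i' hi => ?_, fun i l => ?_,
      fun F hF => ?_⟩
    · rw [← tally_eq]; exact n2 i
    · rw [← tally_eq]; exact n3 l
    · rw [← tally_eq]; exact n4 (i, i') hi (n2 i)
    · rw [← tally_eq]; exact n5 (i, l) (n2 i)
    · have := n6 ⟨F, Finset.mem_powersetCard.2 ⟨Finset.subset_univ _, hF⟩⟩ fun i _ => n2 i
      refine le_trans (Nat.cast_le.2 ?_) this
      rw [← tally_eq]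
      refine tally_mono fun j hj => ⟨hj.1, ?_⟩
      rw [tally_eq]
      exact_mod_cast hj.2
  · linarith

end IsRegime

/-! ### Concentration of sample covariance matrices -/

/-- A Chernoff bound for sums of independent variables. -/
theorem measureReal_le_sum_le {Ω : Type*} [MeasurableSpace Ω] (ν : Measure Ω)
    [IsProbabilityMeasure ν] (n : ℕ) (f : Ω → ℝ) (hf : Integrable (fun ω => Real.exp (f ω)) ν)
    {r : ℝ} (hr : ∫ ω, Real.exp (f ω) ∂ν ≤ Real.exp r) (b : ℝ) :
    (Measure.pi fun _ : Fin n => ν).real {X | b ≤ ∑ k, f (X k)} ≤ Real.exp (n * r - b) := by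
  have h1 : ∀ X : Fin n → Ω, Real.exp (∑ k, f (X k)) = ∏ k, Real.exp (f (X k)) := fun X =>
    Real.exp_sum _ _
  have h2 : Integrable (fun X : Fin n → Ω => Real.exp (∑ k, f (X k)))
      (Measure.pi fun _ : Fin n => ν) := by
    simp_rw [h1]
    exact Integrable.fintype_prod_dep fun _ => hf
  have h3 := mul_meas_ge_le_integral_of_nonneg (Filter.Eventually.of_forall fun X => by positivity)
    h2 (Real.exp b)
  simp_rw [h1] at h3
  rw [integral_fintype_prod_eq_pow (fun ω => Real.exp (f ω)), Fintype.card_fin] at h3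
  rw [Real.exp_sub, le_div_iff₀' (Real.exp_pos _)]
  calc _ ≤ Real.exp b * (Measure.pi fun _ : Fin n => ν).real
          {X | Real.exp b ≤ ∏ k, Real.exp (f (X k))} := by
        refine mul_le_mul_of_nonneg_left (measureReal_mono fun X hX => ?_) (Real.exp_pos _).le
        simp only [Set.mem_ofPred_eq] at hX ⊢
        rw [← h1]
        exact Real.exp_le_exp.2 hX
    _ ≤ _ := h3
    _ ≤ Real.exp r ^ n :=
        pow_le_pow_left₀ (integral_nonneg fun _ => (Real.exp_pos _).le) hr n
    _ = Real.exp (n * r) := by rw [← Real.exp_nat_mul]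

/-- The integral equals `(1 - 2 t) ^ (-1/2)`; a second order estimate of the logarithm gives the
bound. -/
theorem integral_exp_sq_gaussianReal {t : ℝ} (ht : |t| ≤ 1 / 4) :
    Integrable (fun y : ℝ => Real.exp (t * y ^ 2)) (gaussianReal 0 1) ∧
    ∫ y, Real.exp (t * y ^ 2) ∂(gaussianReal 0 1) ≤ Real.exp (t + 4 * t ^ 2) := by
  have ht' := abs_le.1 ht
  have hb : 0 < 1 / 2 - t := by linarith
  have e1 : ∀ y : ℝ, gaussianPDFReal 0 1 y * Real.exp (t * y ^ 2) =
      (√(2 * Real.pi))⁻¹ * Real.exp (-(1 / 2 - t) * y ^ 2) := by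
    intro y
    simp only [gaussianPDFReal, NNReal.coe_one, mul_one, sub_zero]
    rw [mul_assoc, ← Real.exp_add]
    congr 2
    ring
  constructor
  · rw [gaussianReal_of_var_ne_zero _ one_ne_zero,
      integrable_withDensity_iff_integrable_smul' (measurable_gaussianPDF _ _)
        (ae_of_all _ fun _ => gaussianPDF_lt_top)]
    simp only [toReal_gaussianPDF, smul_eq_mul, e1]
    exact (integrable_exp_neg_mul_sq hb).const_mul _
  · rw [integral_gaussianReal_eq_integral_smul one_ne_zero]
    simp only [smul_eq_mul, e1]
    rw [integral_const_mul, integral_gaussian, ← Real.sqrt_inv, ← Real.sqrt_mul (by positivity)]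
    have e2 : (2 * Real.pi)⁻¹ * (Real.pi / (1 / 2 - t)) = (1 - 2 * t)⁻¹ := by
      have := Real.pi_pos
      have : 1 - 2 * t ≠ 0 := by linarith
      field_simp
    rw [e2, Real.sqrt_le_left (Real.exp_pos _).le, ← Real.exp_nat_mul]
    have h0 : 0 < 1 - 2 * t := by linarith
    have hu : |2 * t| ≤ 1 / 2 := by rw [abs_mul, abs_two]; linarith
    have h1 := Real.abs_log_sub_add_sum_range_le (x := 2 * t) (by linarith) 1
    simp only [Finset.range_one, Finset.sum_singleton, zero_add, pow_one, Nat.cast_zero, div_one]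
      at h1
    have h2 : |2 * t| ^ (1 + 1) / (1 - |2 * t|) ≤ 8 * t ^ 2 := by
      rw [div_le_iff₀ (by linarith), show 1 + 1 = 2 from rfl, sq_abs]
      nlinarith [sq_nonneg t]
    have h3 := (abs_le.1 (h1.trans h2)).1
    rw [← Real.exp_log (inv_pos.2 h0), Real.log_inv]
    refine Real.exp_le_exp.2 ?_
    push_cast
    linarith

theorem integral_exp_sq_gaussianReal_var {v t : ℝ} (hv : 0 ≤ v) (ht : |t * v| ≤ 1 / 4) :
    Integrable (fun y : ℝ => Real.exp (t * (y ^ 2 - v))) (gaussianReal 0 v.toNNReal) ∧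
    ∫ y, Real.exp (t * (y ^ 2 - v)) ∂(gaussianReal 0 v.toNNReal) ≤
      Real.exp (4 * (t * v) ^ 2) := by
  have e1 : gaussianReal 0 v.toNNReal = (gaussianReal 0 1).map (√v * ·) := by
    rw [gaussianReal_map_const_mul, mul_zero, mul_one]
    congr 1
    ext
    simp [Real.sq_sqrt hv, hv]
  have e2 : ∀ y : ℝ, Real.exp (t * ((√v * y) ^ 2 - v)) =
      Real.exp (-(t * v)) * Real.exp (t * v * y ^ 2) := by
    intro y
    rw [← Real.exp_add, mul_pow, Real.sq_sqrt hv]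
    congr 1
    ring
  obtain ⟨h1, h2⟩ := integral_exp_sq_gaussianReal ht
  rw [e1]
  constructor
  · rw [integrable_map_measure (by fun_prop) (by fun_prop)]
    simp only [Function.comp_def, e2]
    exact h1.const_mul _
  · rw [integral_map (by fun_prop) (by fun_prop)]
    simp only [e2]
    rw [integral_const_mul]
    calc _ ≤ Real.exp (-(t * v)) * Real.exp (t * v + 4 * (t * v) ^ 2) := by gcongr
      _ = _ := by rw [← Real.exp_add]; congr 1; ring

/-- Empirical variances of a Gaussian variable concentrate. -/
theorem measureReal_empirical_variance_le {Ω : Type*} [MeasurableSpace Ω] (ν : Measure Ω)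
    [IsProbabilityMeasure ν] (n : ℕ) (Y : Ω → ℝ) (hY : Measurable Y) {v V a : ℝ} (hv : 0 ≤ v)
    (hν : ν.map Y = gaussianReal 0 v.toNNReal) (hvV : v ≤ V) (ha : 0 < a) (haV : a ≤ V) :
    (Measure.pi fun _ : Fin n => ν).real {X | n * a ≤ |∑ k, (Y (X k) ^ 2 - v)|} ≤
      2 * Real.exp (-(n * (a ^ 2 / (16 * V ^ 2)))) := by
  have hV : 0 < V := by linarith
  -- This `|t|` minimizes `4 t² V² - |t| a`, with minimum `-a² / (16 V²)`.
  have key : ∀ t : ℝ, |t| = a / (8 * V ^ 2) →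
      (Measure.pi fun _ : Fin n => ν).real {X | n * (a ^ 2 / (8 * V ^ 2)) ≤
        ∑ k, t * (Y (X k) ^ 2 - v)} ≤ Real.exp (-(n * (a ^ 2 / (16 * V ^ 2)))) := by
    intro t ht
    have htv : |t * v| ≤ a / (8 * V) := by
      rw [abs_mul, ht, abs_of_nonneg hv]
      calc a / (8 * V ^ 2) * v ≤ a / (8 * V ^ 2) * V := by gcongr
        _ = a / (8 * V) := by field_simp
    have htv' : |t * v| ≤ 1 / 4 := htv.trans (by rw [div_le_iff₀ (by positivity)]; linarith)
    obtain ⟨h1, h2⟩ := integral_exp_sq_gaussianReal_var hv htv'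
    rw [← hν] at h1 h2
    rw [integrable_map_measure (by fun_prop) hY.aemeasurable] at h1
    rw [integral_map hY.aemeasurable (by fun_prop)] at h2
    have h3 := measureReal_le_sum_le ν n (fun ω => t * (Y ω ^ 2 - v)) h1
      (h2.trans (Real.exp_le_exp.2 (show _ ≤ a ^ 2 / (16 * V ^ 2) by
        rw [← sq_abs]
        calc 4 * |t * v| ^ 2 ≤ 4 * (a / (8 * V)) ^ 2 := by gcongr
          _ = a ^ 2 / (16 * V ^ 2) := by field_simp; norm_num)))
      (n * (a ^ 2 / (8 * V ^ 2)))
    refine h3.trans (le_of_eq ?_)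
    congr 1
    field_simp
    ring
  set t := a / (8 * V ^ 2) with ht
  have ht0 : 0 < t := by positivity
  have h1 := key t (abs_of_pos ht0)
  have h2 := key (-t) (by rw [abs_neg, abs_of_pos ht0])
  have hsub : {X : Fin n → Ω | n * a ≤ |∑ k, (Y (X k) ^ 2 - v)|} ⊆
      {X | n * (a ^ 2 / (8 * V ^ 2)) ≤ ∑ k, t * (Y (X k) ^ 2 - v)} ∪
      {X | n * (a ^ 2 / (8 * V ^ 2)) ≤ ∑ k, -t * (Y (X k) ^ 2 - v)} := by
    intro X hX
    simp only [Set.mem_ofPred_eq, Set.mem_union, ← Finset.mul_sum] at hX ⊢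
    have e : (n : ℝ) * (a ^ 2 / (8 * V ^ 2)) = t * (n * a) := by rw [ht]; ring
    rw [e]
    rcases le_abs.1 hX with h | h
    · exact Or.inl (mul_le_mul_of_nonneg_left h ht0.le)
    · right
      rw [neg_mul, ← mul_neg]
      exact mul_le_mul_of_nonneg_left h ht0.le
  refine (measureReal_mono hsub).trans ((measureReal_union_le _ _).trans ?_)
  linarith

/-- Used with `σ = ±1`, to reduce products of two coordinates to squares of Gaussian variables. -/
theorem map_inner_multivariateGaussian {s : ℕ} {S : Matrix (Fin s) (Fin s) ℝ} (hS : S.PosSemidef)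
    (i j : Fin s) (σ : ℝ) :
    (multivariateGaussian (0 : EuclideanSpace ℝ (Fin s)) S).map (fun x => x i + σ * x j) =
      gaussianReal 0 (S i i + 2 * σ * S i j + σ ^ 2 * S j j).toNNReal := by
  set ν := multivariateGaussian (0 : EuclideanSpace ℝ (Fin s)) S with hν
  set w : EuclideanSpace ℝ (Fin s) :=
    EuclideanSpace.basisFun (Fin s) ℝ i + σ • EuclideanSpace.basisFun (Fin s) ℝ j with hw
  have e1 : (fun x : EuclideanSpace ℝ (Fin s) => x i + σ * x j) = innerSL ℝ w := by
    ext x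
    simp [hw, PiLp.inner_apply]
  have e2 : Var[innerSL ℝ w; ν] = S i i + 2 * σ * S i j + σ ^ 2 * S j j := by
    have h1 := covarianceBilin_self (μ := ν) IsGaussian.memLp_two_id w
    have h2 : ∀ k l, covarianceBilin ν (EuclideanSpace.basisFun (Fin s) ℝ k)
        (EuclideanSpace.basisFun (Fin s) ℝ l) = S k l := by
      intro k l
      rw [hν, covarianceBilin_multivariateGaussian hS]
      simp
    have h3 : S j i = S i j := by simpa using hS.isHermitian.apply i j
    rw [hw] at h1
    simp only [map_add, map_smul, add_apply, smul_apply,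
      h2, smul_eq_mul, h3] at h1
    rw [show (innerSL ℝ w : EuclideanSpace ℝ (Fin s) → ℝ) = fun u => inner ℝ w u from rfl, hw, ← h1]
    ring
  rw [e1, IsGaussian.map_eq_gaussianReal, e2, ContinuousLinearMap.integral_comp_id_comm]
  · simp [hν]
  · exact IsGaussian.integrable_id

theorem measurable_sampleCovariance (s n : ℕ) :
    Measurable fun X : Fin n → EuclideanSpace ℝ (Fin s) =>
      (Matrix.of fun i j => (n : ℝ)⁻¹ * ∑ k, X k i * X k j : Matrix (Fin s) (Fin s) ℝ) := by
  refine measurable_pi_iff.2 fun i => measurable_pi_iff.2 fun j => ?_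
  simp only [Matrix.of_apply]
  fun_prop

instance {s : ℕ} (S : Matrix (Fin s) (Fin s) ℝ) (n : ℕ) : IsProbabilityMeasure (wishart S n) :=
  Measure.isProbabilityMeasure_map (measurable_sampleCovariance s n).aemeasurable

theorem gram_posSemidef {s : ℕ} (A : Matrix (Fin s) (Fin s) ℝ) :
    (A * A.transpose).PosSemidef := by
  simpa [Matrix.conjTranspose_eq_transpose_of_trivial] using
    Matrix.posSemidef_self_mul_conjTranspose A

/-- The entries of a sample covariance matrix are close to those of the covariance matrix. -/
theorem wishart_deviation_le {s : ℕ} (A : Matrix (Fin s) (Fin s) ℝ) {n : ℕ} (hn : 0 < n) {W ε : ℝ}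
    (hW : ∀ i, (A * A.transpose) i i ≤ W) (hε : 0 < ε) (hεW : ε ≤ W) :
    wishart (A * A.transpose) n {M | ∃ i j, ε < |M i j - (A * A.transpose) i j|} ≤
      ENNReal.ofReal (4 * s ^ 2 * Real.exp (-(n * (ε ^ 2 / (64 * W ^ 2))))) := by
  set S := A * A.transpose with hS
  set μ := Measure.pi fun _ : Fin n => multivariateGaussian (0 : EuclideanSpace ℝ (Fin s)) S with hμ
  have hmeas := measurable_sampleCovariance s n
  have hset : MeasurableSet {M : Matrix (Fin s) (Fin s) ℝ | ∃ i j, ε < |M i j - S i j|} := by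
    have e : {M : Matrix (Fin s) (Fin s) ℝ | ∃ i j, ε < |M i j - S i j|} =
        ⋃ i, ⋃ j, {M : Matrix (Fin s) (Fin s) ℝ | ε < |M i j - S i j|} := by ext; simp
    rw [e]
    refine MeasurableSet.iUnion fun i => MeasurableSet.iUnion fun j => ?_
    have h : Measurable fun M : Matrix (Fin s) (Fin s) ℝ => M i j :=
      (measurable_pi_apply j).comp (measurable_pi_apply i)
    exact measurableSet_lt measurable_const (h.sub_const _).abs
  have hW0 : 0 < W := by linarith
  have hnR : (0 : ℝ) < n := by exact_mod_cast hn
  rw [wishart, Measure.map_apply hmeas hset, ← hμ, ← ENNReal.ofReal_toReal (measure_ne_top μ _)]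
  refine ENNReal.ofReal_le_ofReal ?_
  rw [← measureReal_def]
  set B := Real.exp (-(n * (ε ^ 2 / (64 * W ^ 2)))) with hB
  have hvar : ∀ (i j : Fin s) (σ : ℝ), σ ^ 2 = 1 →
      μ.real {X | n * (2 * ε) ≤ |∑ k, ((X k i + σ * X k j) ^ 2 -
        (S i i + 2 * σ * S i j + σ ^ 2 * S j j))|} ≤ 2 * B := by
    intro i j σ hσ
    have hv : ∀ τ : ℝ, S i i + 2 * τ * S i j + τ ^ 2 * S j j = ∑ l, (A i l + τ * A j l) ^ 2 := by
      intro τ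
      simp only [hS, Matrix.mul_apply, Matrix.transpose_apply, Finset.mul_sum,
        ← Finset.sum_add_distrib]
      exact Finset.sum_congr rfl fun l _ => by ring
    have hv0 : ∀ τ : ℝ, 0 ≤ S i i + 2 * τ * S i j + τ ^ 2 * S j j := fun τ => by
      rw [hv]; exact Finset.sum_nonneg fun l _ => sq_nonneg _
    -- Nonnegativity of the variance for the opposite sign bounds this one by `2 (S i i + S j j) ≤ 4
    -- W`.
    have h1 := hv0 (-σ)
    have h2 := measureReal_empirical_variance_le
      (multivariateGaussian (0 : EuclideanSpace ℝ (Fin s)) S) n (fun x => x i + σ * x j)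
      (by fun_prop) (V := 4 * W) (a := 2 * ε) (hv0 σ)
      (map_inner_multivariateGaussian (gram_posSemidef A) i j σ)
      (by have := hW i; have := hW j; rw [neg_sq] at h1; rw [hσ] at h1 ⊢; linarith)
      (by linarith) (by linarith)
    refine h2.trans (le_of_eq ?_)
    rw [hB]
    congr 4
    field_simp
    norm_num
  have hij := measureReal_exists_le μ (fun (p : Fin s × Fin s) X =>
    ε < |(n : ℝ)⁻¹ * ∑ k, X k p.1 * X k p.2 - S p.1 p.2|) (C := 4 * B) (fun p => by
    obtain ⟨i, j⟩ := p
    have hsub : {X : Fin n → EuclideanSpace ℝ (Fin s) |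
        ε < |(n : ℝ)⁻¹ * ∑ k, X k i * X k j - S i j|} ⊆
        {X | n * (2 * ε) ≤ |∑ k, ((X k i + 1 * X k j) ^ 2 -
          (S i i + 2 * 1 * S i j + 1 ^ 2 * S j j))|} ∪
        {X | n * (2 * ε) ≤ |∑ k, ((X k i + -1 * X k j) ^ 2 -
          (S i i + 2 * -1 * S i j + (-1) ^ 2 * S j j))|} := by
      intro X hX
      by_contra hne
      simp only [Set.mem_union, Set.mem_ofPred_eq, not_or, not_le] at hne hX
      -- Polarization: a deviation above `ε` forces one of the two sums of squares to deviate by at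
      -- least `2 n ε`.
      have e : (∑ k, ((X k i + 1 * X k j) ^ 2 - (S i i + 2 * 1 * S i j + 1 ^ 2 * S j j))) -
          ∑ k, ((X k i + -1 * X k j) ^ 2 - (S i i + 2 * -1 * S i j + (-1) ^ 2 * S j j)) =
          4 * n * ((n : ℝ)⁻¹ * ∑ k, X k i * X k j - S i j) := by
        rw [← Finset.sum_sub_distrib, mul_sub, ← mul_assoc, mul_assoc 4,
          mul_inv_cancel₀ hnR.ne', Finset.mul_sum, mul_assoc 4 (n : ℝ)]
        have e3 : (4 : ℝ) * (n * S i j) = ∑ _k : Fin n, 4 * S i j := by simp; ring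
        rw [e3, ← Finset.sum_sub_distrib]
        exact Finset.sum_congr rfl fun k _ => by ring
      have h1 := abs_sub (∑ k, ((X k i + 1 * X k j) ^ 2 -
          (S i i + 2 * 1 * S i j + 1 ^ 2 * S j j)))
        (∑ k, ((X k i + -1 * X k j) ^ 2 - (S i i + 2 * -1 * S i j + (-1) ^ 2 * S j j)))
      rw [e, abs_mul, abs_of_pos (by positivity : (0 : ℝ) < 4 * n)] at h1
      have h2 : 4 * n * ε < 4 * n * |(n : ℝ)⁻¹ * ∑ k, X k i * X k j - S i j| := by gcongr
      have h3 := h2.trans_le (h1.trans (add_lt_add hne.1 hne.2).le)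
      linarith
    refine (measureReal_mono hsub).trans ((measureReal_union_le _ _).trans ?_)
    linarith [hvar i j 1 (by norm_num), hvar i j (-1) (by norm_num)])
  refine (measureReal_mono fun X hX => ?_).trans (hij.trans (le_of_eq ?_))
  · obtain ⟨i, j, h⟩ := hX
    exact ⟨(i, j), h⟩
  · simp only [Fintype.card_prod, Fintype.card_fin]
    push_cast
    ring

/-! ### Recovery -/

instance (r s : ℕ) (θ : unitInterval) : IsProbabilityMeasure (bernoulliGaussian r s θ) :=
  Measure.isProbabilityMeasure_map <| Measurable.aemeasurable <| by
    refine measurable_pi_iff.2 fun i => measurable_pi_iff.2 fun j => ?_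
    simp only [Matrix.of_apply]
    fun_prop

/-! ### The scale, the choice of exponents and the limit of the failure bound. -/

theorem scale_nonneg (b s : ℕ) : 0 ≤ scale b s := by
  cases b with
  | zero => simp [scale]
  | succ b => rw [scale, Function.iterate_succ_apply']; exact Real.sqrt_nonneg _

theorem scale_pow (b s : ℕ) : scale b s ^ 2 ^ b = s := by
  induction b with
  | zero => simp [scale]
  | succ b ih =>
    have h := scale_nonneg b s
    unfold scale at *
    rw [Function.iterate_succ_apply', pow_succ', pow_mul, Real.sq_sqrt h, ih]

theorem tendsto_scale (b : ℕ) : Tendsto (scale b) atTop atTop := by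
  induction b with
  | zero => exact tendsto_natCast_atTop_atTop (R := ℝ)
  | succ b ih =>
    have : scale (b + 1) = fun s => √(scale b s) := by
      ext s
      rw [scale, Function.iterate_succ_apply']
      rfl
    rw [this]
    exact Real.tendsto_sqrt_atTop.comp ih

theorem scale_rpow (b s : ℕ) (a : ℝ) : (s : ℝ) ^ a = scale b s ^ (((2 : ℕ) ^ b : ℕ) * a) := by
  rw [Real.rpow_mul (scale_nonneg b s), Real.rpow_natCast, scale_pow]

/-- At scale `x`, the quantity `s θ` is `x ^ (2 ^ b (1 - α))`, and `κ + 10` is the integer part of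
this exponent. A large `b` makes `κ` positive and provides the margin `x ^ 20` for sparsity. -/
theorem exists_exponents {α : ℝ} (hα : 1 / 2 < α) (hα' : α < 1) (R : ℝ) :
    ∃ b κ : ℕ, R ≤ ((2 ^ b : ℕ) : ℝ) ∧ 1 ≤ κ ∧ (κ + 10 : ℝ) ≤ ((2 ^ b : ℕ) : ℝ) * (1 - α) ∧
      ((2 ^ b : ℕ) : ℝ) * (1 - α) ≤ κ + 11 ∧ 20 ≤ ((2 ^ b : ℕ) : ℝ) * (2 * α - 1) := by
  obtain ⟨b, hb⟩ := pow_unbounded_of_one_lt (max R (max (11 / (1 - α)) (20 / (2 * α - 1))))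
    (one_lt_two : (1 : ℝ) < 2)
  have h1 : R ≤ 2 ^ b := (le_max_left _ _).trans hb.le
  have h2 : 11 / (1 - α) ≤ 2 ^ b := (le_max_left _ _).trans ((le_max_right _ _).trans hb.le)
  have h3 : 20 / (2 * α - 1) ≤ 2 ^ b := (le_max_right _ _).trans ((le_max_right _ _).trans hb.le)
  rw [div_le_iff₀ (by linarith)] at h2 h3
  have h4 : 11 ≤ ⌊(2 : ℝ) ^ b * (1 - α)⌋₊ := Nat.le_floor (by exact_mod_cast h2)
  have h5 := Nat.floor_le (show 0 ≤ (2 : ℝ) ^ b * (1 - α) by linarith)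
  have h6 := Nat.lt_floor_add_one ((2 : ℝ) ^ b * (1 - α))
  have h7 : ((⌊(2 : ℝ) ^ b * (1 - α)⌋₊ - 10 : ℕ) : ℝ) = (⌊(2 : ℝ) ^ b * (1 - α)⌋₊ : ℝ) - 10 := by
    rw [Nat.cast_sub (by omega)]; norm_num
  refine ⟨b, ⌊(2 : ℝ) ^ b * (1 - α)⌋₊ - 10, ?_, by omega, ?_, ?_, ?_⟩
  · exact_mod_cast h1
  · push_cast at h7 ⊢; rw [h7]; linarith
  · push_cast at h7 ⊢; rw [h7]; linarith
  · push_cast; linarith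

theorem eventually_isRegime {α : ℝ} {θ : ℕ → unitInterval}
    (hθ : ∀ s : ℕ, 1 ≤ s → (θ s : ℝ) = (s : ℝ) ^ (-α)) {b κ : ℕ} (hκ : 1 ≤ κ)
    (h1 : (κ + 10 : ℝ) ≤ ((2 ^ b : ℕ) : ℝ) * (1 - α))
    (h2 : ((2 ^ b : ℕ) : ℝ) * (1 - α) ≤ κ + 11)
    (h3 : 20 ≤ ((2 ^ b : ℕ) : ℝ) * (2 * α - 1)) :
    ∀ᶠ s in atTop, IsRegime s (θ s) (scale b s) κ (2 ^ b) := by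
  have hg := gaussianTail_pos
  filter_upwards [eventually_ge_atTop 1,
    (tendsto_scale b).eventually_ge_atTop (8 * ((2 ^ b : ℕ) : ℝ) ^ 2 + 8),
    (tendsto_scale b).eventually_ge_atTop (4 / gaussianTail)] with s hs hx hx'
  have hx1 : 1 ≤ scale b s := by nlinarith [sq_nonneg ((2 ^ b : ℕ) : ℝ)]
  have hx0 : 0 < scale b s := by linarith
  have hs0 : (0 : ℝ) < s := by exact_mod_cast hs
  have e1 : (s : ℝ) * θ s = scale b s ^ (((2 ^ b : ℕ) : ℝ) * (1 - α)) := by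
    rw [hθ s hs, ← scale_rpow, sub_eq_add_neg, Real.rpow_add hs0, Real.rpow_one]
  refine ⟨hx, ?_, hκ, scale_pow b s, ?_, ?_, ?_⟩
  · rwa [div_le_iff₀' hg] at hx'
  · rw [e1, ← Real.rpow_natCast]
    exact Real.rpow_le_rpow_of_exponent_le hx1 (by push_cast at h1 ⊢; exact h1)
  · rw [e1, ← Real.rpow_natCast]
    exact Real.rpow_le_rpow_of_exponent_le hx1 (by push_cast at h2 ⊢; exact h2)
  · have e2 : (s : ℝ) * (θ s : ℝ) ^ 2 = scale b s ^ (((2 ^ b : ℕ) : ℝ) * (1 - 2 * α)) := by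
      rw [hθ s hs, ← scale_rpow, ← Real.rpow_natCast, ← Real.rpow_mul hs0.le,
        show 1 - 2 * α = 1 + -α * (2 : ℕ) by push_cast; ring, Real.rpow_add hs0, Real.rpow_one]
    rw [e2, ← Real.rpow_natCast, ← Real.rpow_add hx0]
    exact Real.rpow_le_one_of_one_le_of_nonpos hx1 (by push_cast at h3 ⊢; linarith)

/-- The bound for the probability of failure. -/
noncomputable def failureBound (b s : ℕ) : ℝ :=
  60000 * (s : ℝ) ^ (2 * 2 ^ b + 2) * Real.exp (-(scale b s / 2))

theorem tendsto_failureBound (b : ℕ) :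
    Tendsto (fun s => ENNReal.ofReal (failureBound b s)) atTop (𝓝 0) := by
  have h1 := (Real.tendsto_pow_mul_exp_neg_atTop_nhds_zero (2 ^ b * (2 * 2 ^ b + 2))).comp
    ((tendsto_scale b).atTop_div_const (two_pos))
  have h2 := (h1.const_mul (60000 * 2 ^ (2 ^ b * (2 * 2 ^ b + 2))))
  rw [mul_zero] at h2
  have h3 : Tendsto (failureBound b) atTop (𝓝 0) := by
    refine h2.congr fun s => ?_
    have e : (s : ℝ) ^ (2 * 2 ^ b + 2) = scale b s ^ (2 ^ b * (2 * 2 ^ b + 2)) := by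
      rw [pow_mul, scale_pow]
    simp only [Function.comp_apply, failureBound, e, div_pow]
    field_simp
  simpa using ENNReal.tendsto_ofReal h3

theorem IsTypical.gram_diag_le {s κ c : ℕ} {x : ℝ} {A : Matrix (Fin s) (Fin s) ℝ}
    (hA : IsTypical x κ c A) (i : Fin s) : (A * A.transpose) i i ≤ x ^ (κ + 14) := by
  classical
  have h1 : (A * A.transpose) i i = ∑ l ∈ Finset.univ.filter fun l => A i l ≠ 0, A i l * A i l := by
    rw [Matrix.mul_apply, Finset.sum_filter]
    refine Finset.sum_congr rfl fun l _ => ?_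
    by_cases h : A i l = 0 <;> simp [h]
  rw [h1]
  refine (Finset.sum_le_card_nsmul _ _ (x ^ 2) fun l _ => ?_).trans ?_
  · rw [← sq, ← sq_abs]
    exact pow_le_pow_left₀ (abs_nonneg _) (hA.bound i l) 2
  · rw [nsmul_eq_mul]
    have h2 := hA.row_card i
    calc _ ≤ x ^ (κ + 12) * x ^ 2 := mul_le_mul_of_nonneg_right (by convert h2) (sq_nonneg x)
      _ = x ^ (κ + 14) := by ring

/-- The search finds a matrix which is close to `A`. -/
theorem IsRegime.recoveryDist_le {s κ b : ℕ} {θ : unitInterval}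
    (h : IsRegime s θ (scale b s) κ (2 ^ b)) (hb : (20 : ℝ) ≤ ((2 ^ b : ℕ) : ℝ))
    {A M V : Matrix (Fin s) (Fin s) ℝ} (hA : IsTypical (scale b s) κ (2 ^ b) A)
    (hM : ∀ i j, |M i j - (A * A.transpose) i j| ≤ 1 / scale b s ^ 11)
    (hV : (∃ V, IsGrid V ∧ Accepts (scale b s) κ M V) → Accepts (scale b s) κ M V) :
    recoveryDist V A ≤ 12 / scale b s ^ 6 := by
  refine hA.recoveryDist_le h.eight_le h.large hM (hV (hA.exists_accepts h.eight_le ?_ hM))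
  rw [← scale_pow b s]
  exact pow_le_pow_right₀ h.one_le (by exact_mod_cast hb)

theorem eventually_error_lt (b : ℕ) {η : ℝ} (hη : 0 < η) :
    ∀ᶠ s in atTop, 12 / scale b s ^ 6 < η := by
  have : Tendsto (fun s => 12 / scale b s ^ 6) atTop (𝓝 0) :=
    ((tendsto_pow_atTop (by norm_num)).comp (tendsto_scale b)).const_div_atTop 12
  exact this.eventually (gt_mem_nhds hη)

end SparseICA

theorem corollary2 (α : ℝ) (hα : 1 / 2 < α) (hα' : α < 1)
    (θ : ℕ → unitInterval) (hθ : ∀ s : ℕ, 1 ≤ s → (θ s : ℝ) = (s : ℝ) ^ (-α)) :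
    -- input: the population covariance matrix
    (∃ (P : SparseICA.Program)
        (alg : (s : ℕ) → Matrix (Fin s) (Fin s) ℝ → Matrix (Fin s) (Fin s) ℝ),
      P.Computes alg ∧
      ∀ η : ℝ, 0 < η →
        Tendsto (fun s : ℕ => SparseICA.bernoulliGaussian s s (θ s)
          {A | η ≤ SparseICA.recoveryDist (alg s (A * A.transpose)) A}) atTop (𝓝 0)) ∧
    -- input: a Wishart sample covariance matrix, with `n = s ^ (2 * β)` up to rounding
    (∀ β : ℝ, max (3 - 4 * α) (1 - α) < β →
      ∃ (P : SparseICA.Program)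
        (alg : (s : ℕ) → Matrix (Fin s) (Fin s) ℝ → Matrix (Fin s) (Fin s) ℝ),
      P.Computes alg ∧
      ∀ n : ℕ → ℕ, (∀ s : ℕ, |(n s : ℝ) - (s : ℝ) ^ (2 * β)| < 1) →
      ∀ η : ℝ, 0 < η →
        Tendsto (fun s : ℕ =>
          ∫⁻ A, SparseICA.wishart (A * A.transpose) (n s)
              {M | η ≤ SparseICA.recoveryDist (alg s M) A}
            ∂(SparseICA.bernoulliGaussian s s (θ s))) atTop (𝓝 0)) := by
  open SparseICA in
  constructor
  · obtain ⟨b, κ, hb, hκ, h1, h2, h3⟩ := exists_exponents hα hα' 20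
    obtain ⟨P, alg, hP, halg⟩ := exists_search_program b κ
    refine ⟨P, alg, hP, fun η hη => ?_⟩
    refine tendsto_of_tendsto_of_tendsto_of_le_of_le' tendsto_const_nhds (tendsto_failureBound b)
      (Eventually.of_forall fun _ => zero_le) ?_
    filter_upwards [eventually_isRegime hθ hκ h1 h2 h3, eventually_error_lt b hη] with s hs hη'
    -- Monotonicity holds for outer measures, so the failure event need not be measurable.
    refine (measure_mono fun A hA => ?_).trans hs.prob_not_typical
    intro htyp
    have h4 := hs.recoveryDist_le hb htyp (M := A * A.transpose) (fun i j => by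
      rw [sub_self, abs_zero]
      have := hs.one_le
      positivity) (halg s _)
    have hA' : η ≤ recoveryDist (alg s (A * A.transpose)) A := hA
    linarith
  · intro β hβ
    have hβ' : 0 < β - (1 - α) := sub_pos.2 ((le_max_right _ _).trans_lt hβ)
    -- The `30` gives `2 ^ b β ≥ κ + 10 + 30`, that is, `s ^ (2 β) ≥ x ^ (2 κ + 80)`.
    obtain ⟨b, κ, hb, hκ, h1, h2, h3⟩ := exists_exponents hα hα' (max 20 (30 / (β - (1 - α))))
    have hb20 := (le_max_left _ _).trans hb
    have hb30 := (le_max_right _ _).trans hb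
    rw [div_le_iff₀ hβ'] at hb30
    obtain ⟨P, alg, hP, halg⟩ := exists_search_program b κ
    refine ⟨P, alg, hP, fun n hn η hη => ?_⟩
    have hlim := (tendsto_failureBound b).add (tendsto_failureBound b)
    rw [add_zero] at hlim
    refine tendsto_of_tendsto_of_tendsto_of_le_of_le' tendsto_const_nhds hlim
      (Eventually.of_forall fun _ => zero_le) ?_
    filter_upwards [eventually_isRegime hθ hκ h1 h2 h3, eventually_error_lt b hη] with s hs hη'
    have hx1 := hs.one_le
    have hx8 := hs.eight_le
    set x := scale b s with hx
    have hx0 : 0 < x := by linarith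
    have hn1 : 64 * x ^ (2 * κ + 51) ≤ n s := by
      have e1 : x ^ (2 * κ + 80) ≤ (s : ℝ) ^ (2 * β) := by
        rw [scale_rpow b, ← Real.rpow_natCast, ← hx]
        refine Real.rpow_le_rpow_of_exponent_le hx1 ?_
        push_cast at h1 hb30 ⊢
        nlinarith
      -- Rounding costs less than `1`, absorbed by passing from the factor `65` to `64`.
      have e2 := (abs_lt.1 (hn s)).1
      have e3 : x ^ (2 * κ + 80) = x ^ 29 * x ^ (2 * κ + 51) := by ring
      have e4 : (65 : ℝ) ≤ x ^ 29 := by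
        calc (65 : ℝ) ≤ 8 ^ 29 := by norm_num
          _ ≤ x ^ 29 := by gcongr
      have e5 : 1 ≤ x ^ (2 * κ + 51) := one_le_pow₀ hx1
      nlinarith
    have hn0 : 0 < n s := by
      have : (0 : ℝ) < n s := lt_of_lt_of_le (by positivity) hn1
      exact_mod_cast this
    have hwish : ∀ A : Matrix (Fin s) (Fin s) ℝ, IsTypical x κ (2 ^ b) A →
        wishart (A * A.transpose) (n s) {M | η ≤ recoveryDist (alg s M) A} ≤
          ENNReal.ofReal (failureBound b s) := by
      intro A hA
      have hε : 1 / x ^ 11 ≤ x ^ (κ + 14) := by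
        have e1 : 1 ≤ x ^ 11 := one_le_pow₀ hx1
        have e2 : 1 ≤ x ^ (κ + 14) := one_le_pow₀ hx1
        rw [div_le_iff₀ (by positivity)]
        nlinarith
      have h4 := wishart_deviation_le A hn0 hA.gram_diag_le (ε := 1 / x ^ 11) (by positivity) hε
      refine (measure_mono fun M hM => ?_).trans (h4.trans (ENNReal.ofReal_le_ofReal ?_))
      · by_contra hne
        simp only [Set.mem_ofPred_eq, not_exists, not_lt] at hne
        have h5 := hs.recoveryDist_le hb20 hA hne (halg s M)
        have hM' : η ≤ recoveryDist (alg s M) A := hM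
        linarith
      · rw [failureBound, ← hx]
        have hs1 : (1 : ℝ) ≤ s := by rw [← scale_pow b s]; exact one_le_pow₀ hx1
        -- With `ε = x ^ (-11)` and `W = x ^ (κ + 14)` the exponent is `n / (64 x ^ (2 κ + 50))`,
        -- which explains the lower bound on `n`.
        have e1 : x / 2 ≤ n s * ((1 / x ^ 11) ^ 2 / (64 * (x ^ (κ + 14)) ^ 2)) := by
          have e2 : (1 / x ^ 11) ^ 2 / (64 * (x ^ (κ + 14)) ^ 2) = 1 / (64 * x ^ (2 * κ + 50)) := by
            field_simp
            ring
          rw [e2, mul_one_div, le_div_iff₀ (by positivity)]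
          have e3 : x ^ (2 * κ + 51) = x * x ^ (2 * κ + 50) := by ring
          have : 0 < x * x ^ (2 * κ + 50) := by positivity
          nlinarith
        have e4 : (s : ℝ) ^ 2 ≤ s ^ (2 * 2 ^ b + 2) := pow_le_pow_right₀ hs1 (by omega)
        gcongr
        norm_num
    -- The inner probability is at most `1` for an atypical `A` and at most the failure bound for a
    -- typical one. The inequalities used for the lower integral require no measurability in `A`.
    calc _ ≤ ∫⁻ A, (Set.indicator {A | ¬ IsTypical x κ (2 ^ b) A} (fun _ => 1) A +
            ENNReal.ofReal (failureBound b s)) ∂(bernoulliGaussian s s (θ s)) := by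
          refine lintegral_mono fun A => ?_
          by_cases hA : IsTypical x κ (2 ^ b) A
          · exact (hwish A hA).trans le_add_self
          · simp only [Set.indicator, Set.mem_ofPred_eq, hA, not_false_eq_true, if_true]
            exact prob_le_one.trans le_self_add
      _ = ∫⁻ A, Set.indicator {A | ¬ IsTypical x κ (2 ^ b) A} (fun _ => 1) A
            ∂(bernoulliGaussian s s (θ s)) + ENNReal.ofReal (failureBound b s) := by
          rw [lintegral_add_right _ measurable_const, lintegral_const, measure_univ, mul_one]
      _ ≤ _ := by
          refine add_le_add ((lintegral_indicator_const_le _ 1).trans ?_) le_rfl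
          rw [one_mul]
          exact hs.prob_not_typical
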